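/- Let $p\ge 1$ and $n_0>p$ be integers. For $\ell=0,1,2,\dots$ put $n_\ell=n_02^\ell$, $h_\ell=1/n_\ell$, and let $S_{p,\ell}$ be the space of all functions in $C^{p-1}(0,1)$ that are polynomials of degree at most $p$ on each subinterval $((i-1)h_\ell,ih_\ell)$, $i=1,\dots,n_\ell$, extended continuously (with one-sided derivatives) to $[0,1]$. Then $S_{p,\ell-1}\subset S_{p,\ell}$. Let $\widetilde S_{p,\ell}$ be the subspace of all $u\in S_{p,\ell}$ with $u^{(2l+1)}(0)=u^{(2l+1)}(1)=0$ for all integers $l\ge 0$ with $2l+1<p$. Let $$(u,v)_A=\int_0^1 u'v'\,dx+\int_0^1 uv\,dx .$$ On each level choose a basis of $S_{p,\ell}$ (for example the B-spline basis). Let $A_\ell$ and $M_\ell$ be the matrices of $(\cdot,\cdot)_A$ and of the $L^2(0,1)$ scalar product in this basis, let $I_{\ell-1}^\ell$ be the matrix of the embedding $S_{p,\ell-1}\subset S_{p,\ell}$, and let $I_\ell^{\ell-1}=(I_{\ell-1}^\ell)^T$. On each level let $S^I_{p,\ell}\subseteq\widetilde S_{p,\ell}$ be an arbitrary subspace, let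 $T^I_\ell$ be the $A$-orthogonal projector of $S_{p,\ell}$ onto $S^I_{p,\ell}$ (and also its matrix), and let $$L_\ell=h_\ell^{-2}M_\ell+(I-T^I_\ell)^TA_\ell(I-T^I_\ell).$$ For the system $A_\ell u=f$, one smoothing step with damping parameter $\tau$ is $u\mapsto u+\tau L_\ell^{-1}(f-A_\ell u)$. One step of the two-grid method on level $\ell\ge 1$ consists of $\nu$ smoothing steps followed by the exact coarse-grid correction $u\mapsto u+I_{\ell-1}^\ell A_{\ell-1}^{-1}I_\ell^{\ell-1}(f-A_\ell u)$. One step of the symmetric W-cycle with $\nu/2$ pre- and $\nu/2$ post-smoothing steps ($\nu$ even) is defined recursively: on level $0$ the system is solved exactly; on level $\ell\ge1$ one performs $\nu/2$ smoothing steps, then adds $I_{\ell-1}^\ell c$, where $c$ is the result of two steps of the W-cycle on level $\ell-1$, with starting value $0$, for the system $A_{\ell-1}c=I_\ell^{\ell-1}(f-A_\ell u)$ ($u$ being the current iterate), and then performs another $\nu/2$ smoothing steps. For a symmetric positive definite matrix $Q$ write $\|v\|_Q=(Qv,v)^{1/2}$ with the Euclidean scalar product. **Theorem.** There exist $\tau>0$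 and $\nu_0>0$, independent of $\ell$, $p$, $n_0$, the bases and the subspaces $S^I_{p,\ell}$, such that for all data as above the matrices $A_\ell$ and $L_\ell$ are symmetric positive definite on every level, and the following holds for every right-hand side $f$, with exact solution $u^*$ of $A_\ell u^*=f$, and every starting vector $u^{(0)}$. 1. For every $\ell\ge1$ and every integer $\nu>\nu_0$, the result $u^{(1)}$ of one step of the two-grid method with $\nu$ smoothing steps applied to $u^{(0)}$ satisfies $$\|u^*-u^{(1)}\|_{L_\ell}\le\frac{\nu_0}{\nu}\,\|u^*-u^{(0)}\|_{L_\ell}.$$ 2. For every $\ell\ge0$ and every even integer $\nu>4\nu_0$, the result $u^{(1)}$ of one step of the W-cycle with $\nu/2$ pre- and $\nu/2$ post-smoothing steps applied to $u^{(0)}$ satisfies $$\|u^*-u^{(1)}\|_{A_\ell}\le\frac{2\nu_0}{\nu}\,\|u^*-u^{(0)}\|_{A_\ell}.$$ -/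

import Mathlib

open MeasureTheory Set
open scoped Matrix

noncomputable section

/-! ### Splines of maximum smoothness on `(0,1)` -/

/-- The spline space `S_p` of maximum smoothness on the uniform grid of `(0,1)` with `n` cells of
length `1 / n`: functions of class `C^(p-1)` that are polynomials of degree at most `p` on every
cell `(i / n, (i + 1) / n)`. Such a function extends uniquely to a `C^(p-1)` function on `[0,1]`;
as a function on `ℝ` it is represented by the extension of that one by zero. (Here `1 ≤ p`.) -/
def SplineSpace (p n : ℕ) : Submodule ℝ (ℝ → ℝ) where
  carrier := {u | (∀ x, x ∉ Icc (0 : ℝ) 1 → u x = 0) ∧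
    ContDiffOn ℝ ((p - 1 : ℕ) : WithTop ℕ∞) u (Icc (0 : ℝ) 1) ∧
    ∀ i < n, ∃ q : Polynomial ℝ, q.natDegree ≤ p ∧
      ∀ x ∈ Ioo ((i : ℝ) / n) (((i : ℝ) + 1) / n), u x = q.eval x}
  zero_mem' := ⟨fun _ _ => rfl, contDiffOn_const, fun _ _ => ⟨0, by simp, fun _ _ => by simp⟩⟩
  add_mem' := by
    rintro u v ⟨hu₀, hu₁, hu₂⟩ ⟨hv₀, hv₁, hv₂⟩
    refine ⟨fun x hx => by simp [hu₀ x hx, hv₀ x hx], hu₁.add hv₁, fun i hi => ?_⟩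
    obtain ⟨q, hq, hqu⟩ := hu₂ i hi
    obtain ⟨r, hr, hrv⟩ := hv₂ i hi
    exact ⟨q + r, (Polynomial.natDegree_add_le q r).trans (max_le hq hr),
      fun x hx => by simp [hqu x hx, hrv x hx]⟩
  smul_mem' := by
    rintro c u ⟨hu₀, hu₁, hu₂⟩
    refine ⟨fun x hx => by simp [hu₀ x hx], hu₁.const_smul c, fun i hi => ?_⟩
    obtain ⟨q, hq, hqu⟩ := hu₂ i hi
    exact ⟨c • q, (Polynomial.natDegree_smul_le c q).trans hq,
      fun x hx => by simp [hqu x hx]⟩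

/-- The subspace `S̃_p` of the splines all of whose derivatives of odd order `2 * l + 1 < p` vanish
at both boundary points (one-sided derivatives). -/
def ReducedSplineSpace (p n : ℕ) : Submodule ℝ (SplineSpace p n) where
  carrier := {u | ∀ l : ℕ, 2 * l + 1 < p →
    iteratedDerivWithin (2 * l + 1) (u : ℝ → ℝ) (Icc (0 : ℝ) 1) 0 = 0 ∧
    iteratedDerivWithin (2 * l + 1) (u : ℝ → ℝ) (Icc (0 : ℝ) 1) 1 = 0}
  zero_mem' := fun l _ => by
    have h : (((0 : SplineSpace p n) : ℝ → ℝ)) = (0 : ℝ) • (fun _ => (0 : ℝ)) := by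
      ext; simp
    rw [h, iteratedDerivWithin_const_smul_field, iteratedDerivWithin_const_smul_field]
    simp only [zero_smul, and_self]
  add_mem' := by
    intro u v hu hv l hl
    have hd : ∀ w : SplineSpace p n, ContDiffOn ℝ ((2 * l + 1 : ℕ) : WithTop ℕ∞)
        (w : ℝ → ℝ) (Icc (0 : ℝ) 1) := fun w => w.2.2.1.of_le (by
      exact_mod_cast (show 2 * l + 1 ≤ p - 1 by omega))
    have hs : UniqueDiffOn ℝ (Icc (0 : ℝ) 1) := uniqueDiffOn_Icc_zero_one
    have h0 : (0 : ℝ) ∈ Icc (0 : ℝ) 1 := by simp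
    have h1 : (1 : ℝ) ∈ Icc (0 : ℝ) 1 := by simp
    rw [Submodule.coe_add, iteratedDerivWithin_add h0 hs (hd u 0 h0) (hd v 0 h0),
      iteratedDerivWithin_add h1 hs (hd u 1 h1) (hd v 1 h1), (hu l hl).1, (hu l hl).2,
      (hv l hl).1, (hv l hl).2]
    simp
  smul_mem' := by
    intro c u hu l hl
    rw [Submodule.coe_smul, iteratedDerivWithin_const_smul_field,
      iteratedDerivWithin_const_smul_field, (hu l hl).1, (hu l hl).2]
    simp

/-- Uniform dyadic refinement makes the spline spaces nested. -/
theorem SplineSpace.le_succ (p n₀ ℓ : ℕ) :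
    SplineSpace p (n₀ * 2 ^ ℓ) ≤ SplineSpace p (n₀ * 2 ^ (ℓ + 1)) := by
  rw [pow_succ, ← mul_assoc]
  generalize n₀ * 2 ^ ℓ = n
  rintro u ⟨hu₀, hu₁, hu₂⟩
  refine ⟨hu₀, hu₁, fun i hi => ?_⟩
  obtain ⟨q, hq, hqu⟩ := hu₂ (i / 2) (by omega)
  refine ⟨q, hq, fun x hx => hqu x ?_⟩
  have hn : (0 : ℝ) < n := by
    have : 0 < n := by omega
    exact_mod_cast this
  have h1 : (2 : ℝ) * ((i / 2 : ℕ) : ℝ) ≤ i := by exact_mod_cast Nat.mul_div_le i 2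
  have h2 : (i : ℝ) + 1 ≤ 2 * (((i / 2 : ℕ) : ℝ) + 1) := by
    exact_mod_cast (show i + 1 ≤ 2 * (i / 2 + 1) by omega)
  obtain ⟨hx1, hx2⟩ := hx
  push_cast at hx1 hx2
  rw [div_lt_iff₀ (by positivity)] at hx1
  rw [lt_div_iff₀ (by positivity)] at hx2
  constructor
  · rw [div_lt_iff₀ hn]; linarith
  · rw [lt_div_iff₀ hn]; linarith

/-! ### The mass form and the energy form -/

section Forms

theorem SplineSpace.continuousOn {p n : ℕ} (u : SplineSpace p n) :
    ContinuousOn (u : ℝ → ℝ) (Icc (0 : ℝ) 1) := u.2.2.1.continuousOn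

theorem SplineSpace.hasDerivAt_cell {p n : ℕ} (u : SplineSpace p n) {i : ℕ} (hi : i < n) :
    ∃ q : Polynomial ℝ, ∀ x ∈ Ioo ((i : ℝ) / n) (((i : ℝ) + 1) / n),
      HasDerivAt (u : ℝ → ℝ) (q.eval x) x := by
  obtain ⟨q, -, hq⟩ := u.2.2.2 i hi
  refine ⟨Polynomial.derivative q, fun x hx => (q.hasDerivAt x).congr_of_eventuallyEq ?_⟩
  filter_upwards [isOpen_Ioo.mem_nhds hx] with y hy using hq y hy

variable {p n : ℕ} [NeZero n]

/-- Off the finitely many grid points, every point of `[0,1]` lies in an open cell. -/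
theorem exists_cell {x : ℝ} (hx : x ∈ Icc (0 : ℝ) 1)
    (hk : ∀ i ≤ n, x ≠ (i : ℝ) / n) :
    ∃ i < n, x ∈ Ioo ((i : ℝ) / n) (((i : ℝ) + 1) / n) := by
  have hn : (0 : ℝ) < n := by exact_mod_cast NeZero.pos n
  have hxn : 0 ≤ x * n := mul_nonneg hx.1 hn.le
  have h1 : (⌊x * n⌋₊ : ℝ) ≤ x * n := Nat.floor_le hxn
  have h2 : x * n < ⌊x * n⌋₊ + 1 := Nat.lt_floor_add_one _
  have h3 : ⌊x * n⌋₊ ≤ n := by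
    have : (⌊x * n⌋₊ : ℝ) ≤ n := h1.trans (by nlinarith [hx.2])
    exact_mod_cast this
  have h4 : (⌊x * n⌋₊ : ℝ) / n < x := by
    refine lt_of_le_of_ne ?_ (hk _ h3).symm
    rwa [div_le_iff₀ hn]
  refine ⟨⌊x * n⌋₊, ?_, h4, by rwa [lt_div_iff₀ hn]⟩
  refine lt_of_le_of_ne h3 fun h => ?_
  rw [h, div_self hn.ne'] at h4
  exact absurd h4 (not_lt.2 hx.2)

theorem ae_exists_cell : ∀ᵐ x ∂(volume.restrict (Icc (0 : ℝ) 1)),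
    ∃ i < n, x ∈ Ioo ((i : ℝ) / n) (((i : ℝ) + 1) / n) := by
  rw [ae_restrict_iff' measurableSet_Icc]
  have hfin : ((fun i : ℕ => (i : ℝ) / n) '' (Set.Iic n)).Finite := (Set.finite_Iic n).image _
  filter_upwards [hfin.countable.ae_notMem volume] with x hx hx01
  exact exists_cell hx01 fun i hi h => hx ⟨i, hi, h.symm⟩

theorem SplineSpace.ae_differentiableAt (u : SplineSpace p n) :
    ∀ᵐ x ∂(volume.restrict (Icc (0 : ℝ) 1)), DifferentiableAt ℝ (u : ℝ → ℝ) x := by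
  filter_upwards [ae_exists_cell (n := n)] with x hx
  obtain ⟨i, hi, hx⟩ := hx
  obtain ⟨q, hq⟩ := SplineSpace.hasDerivAt_cell u hi
  exact (hq x hx).differentiableAt

theorem SplineSpace.intervalIntegrable_mul (u v : SplineSpace p n) :
    IntervalIntegrable (fun x => (u : ℝ → ℝ) x * (v : ℝ → ℝ) x) volume 0 1 :=
  ContinuousOn.intervalIntegrable (by
    rw [uIcc_of_le zero_le_one]; exact (SplineSpace.continuousOn u).mul (SplineSpace.continuousOn v))

theorem SplineSpace.intervalIntegrable_deriv_mul (u v : SplineSpace p n) :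
    IntervalIntegrable (fun x => deriv (u : ℝ → ℝ) x * deriv (v : ℝ → ℝ) x) volume 0 1 := by
  have hn : (0 : ℝ) < n := by exact_mod_cast NeZero.pos n
  have key := IntervalIntegrable.trans_iterate (μ := volume) (n := n)
    (f := fun x => deriv (u : ℝ → ℝ) x * deriv (v : ℝ → ℝ) x)
    (a := fun i : ℕ => (i : ℝ) / n) ?_
  · simpa [hn.ne'] using key
  intro i hi
  obtain ⟨q, hq⟩ := SplineSpace.hasDerivAt_cell u hi
  obtain ⟨r, hr⟩ := SplineSpace.hasDerivAt_cell v hi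
  have hc : IntervalIntegrable (fun x => q.eval x * r.eval x) volume ((i : ℝ) / n)
      (((i + 1 : ℕ) : ℝ) / n) :=
    (q.continuous.mul r.continuous).intervalIntegrable _ _
  refine hc.congr_uIoo fun x hx => ?_
  have hle : (i : ℝ) / n ≤ ((i + 1 : ℕ) : ℝ) / n := by push_cast; gcongr; linarith
  rw [uIoo_of_le hle] at hx
  push_cast at hx
  simp only [(hq x hx).deriv, (hr x hx).deriv]

variable (p n) in
/-- The `L²(0,1)` scalar product on the spline space. -/
def massForm : LinearMap.BilinForm ℝ (SplineSpace p n) :=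
  LinearMap.mk₂ ℝ (fun u v => ∫ x in (0 : ℝ)..1, (u : ℝ → ℝ) x * (v : ℝ → ℝ) x)
    (fun u₁ u₂ v => by
      rw [← intervalIntegral.integral_add (SplineSpace.intervalIntegrable_mul u₁ v)
        (SplineSpace.intervalIntegrable_mul u₂ v)]
      simp [add_mul])
    (fun c u v => by
      rw [smul_eq_mul, ← intervalIntegral.integral_const_mul]
      simp [mul_assoc])
    (fun u v₁ v₂ => by
      rw [← intervalIntegral.integral_add (SplineSpace.intervalIntegrable_mul u v₁)
        (SplineSpace.intervalIntegrable_mul u v₂)]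
      simp [mul_add])
    (fun c u v => by
      rw [smul_eq_mul, ← intervalIntegral.integral_const_mul]
      simp [mul_left_comm])

variable (p n) in
/-- The form `(Du, Dv)` in `L²(0,1)`. The derivative of a spline exists off the finitely many grid
points (and is its weak derivative). -/
def gradForm : LinearMap.BilinForm ℝ (SplineSpace p n) :=
  LinearMap.mk₂ ℝ (fun u v => ∫ x in (0 : ℝ)..1, deriv (u : ℝ → ℝ) x * deriv (v : ℝ → ℝ) x)
    (fun u₁ u₂ v => by
      rw [← intervalIntegral.integral_add (SplineSpace.intervalIntegrable_deriv_mul u₁ v)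
        (SplineSpace.intervalIntegrable_deriv_mul u₂ v)]
      simp only [intervalIntegral.integral_of_le zero_le_one, ← integral_Icc_eq_integral_Ioc]
      refine integral_congr_ae ?_
      filter_upwards [SplineSpace.ae_differentiableAt u₁, SplineSpace.ae_differentiableAt u₂] with x h₁ h₂
      simp [deriv_add h₁ h₂, add_mul])
    (fun c u v => by
      rw [smul_eq_mul, ← intervalIntegral.integral_const_mul]
      simp [deriv_const_smul_field, mul_assoc])
    (fun u v₁ v₂ => by
      rw [← intervalIntegral.integral_add (SplineSpace.intervalIntegrable_deriv_mul u v₁)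
        (SplineSpace.intervalIntegrable_deriv_mul u v₂)]
      simp only [intervalIntegral.integral_of_le zero_le_one, ← integral_Icc_eq_integral_Ioc]
      refine integral_congr_ae ?_
      filter_upwards [SplineSpace.ae_differentiableAt v₁, SplineSpace.ae_differentiableAt v₂] with x h₁ h₂
      simp [deriv_add h₁ h₂, mul_add])
    (fun c u v => by
      rw [smul_eq_mul, ← intervalIntegral.integral_const_mul]
      simp [deriv_const_smul_field, mul_left_comm])

variable (p n) in
/-- The energy scalar product `(u, v)_A = (Du, Dv) + (u, v)` in `L²(0,1)`, i.e. the bilinear form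
of `-D²u + u = f` with homogeneous Neumann boundary conditions. -/
def energyForm : LinearMap.BilinForm ℝ (SplineSpace p n) := gradForm p n + massForm p n

theorem energyForm_apply (u v : SplineSpace p n) : energyForm p n u v =
    (∫ x in (0 : ℝ)..1, deriv (u : ℝ → ℝ) x * deriv (v : ℝ → ℝ) x) +
      ∫ x in (0 : ℝ)..1, (u : ℝ → ℝ) x * (v : ℝ → ℝ) x := rfl

theorem SplineSpace.eq_zero_of_ae (u : SplineSpace p n)
    (h : (u : ℝ → ℝ) =ᵐ[volume.restrict (Icc (0 : ℝ) 1)] 0) : u = 0 := by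
  have hE := Measure.eqOn_Icc_of_ae_eq (μ := volume) (zero_ne_one' ℝ) h (SplineSpace.continuousOn u)
    continuousOn_const
  ext x
  by_cases hx : x ∈ Icc (0 : ℝ) 1
  · exact hE hx
  · exact u.2.1 x hx

theorem eq_zero_of_energyForm_self (u : SplineSpace p n) (h : energyForm p n u u = 0) :
    u = 0 := by
  rw [energyForm_apply] at h
  have h1 : 0 ≤ ∫ x in (0 : ℝ)..1, deriv (u : ℝ → ℝ) x * deriv (u : ℝ → ℝ) x :=
    intervalIntegral.integral_nonneg zero_le_one fun x _ => mul_self_nonneg _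
  have h2 : 0 ≤ ∫ x in (0 : ℝ)..1, (u : ℝ → ℝ) x * (u : ℝ → ℝ) x :=
    intervalIntegral.integral_nonneg zero_le_one fun x _ => mul_self_nonneg _
  have h3 : ∫ x in (0 : ℝ)..1, (u : ℝ → ℝ) x * (u : ℝ → ℝ) x = 0 := by linarith
  have hi := SplineSpace.intervalIntegrable_mul u u
  rw [intervalIntegrable_iff_integrableOn_Icc_of_le zero_le_one] at hi
  rw [intervalIntegral.integral_of_le zero_le_one, ← integral_Icc_eq_integral_Ioc,
    integral_eq_zero_iff_of_nonneg (fun x => mul_self_nonneg _) hi] at h3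
  refine SplineSpace.eq_zero_of_ae u ?_
  filter_upwards [h3] with x hx using by simpa using hx

instance SplineSpace.finiteDimensional : FiniteDimensional ℝ (SplineSpace p n) := by
  have hn : (0 : ℝ) < n := by exact_mod_cast NeZero.pos n
  -- sample every cell at `p + 1` interior points
  let pt : Fin n → Fin (p + 1) → ℝ := fun i j => ((i : ℝ) + ((j : ℝ) + 1) / ((p : ℝ) + 2)) / n
  let E : SplineSpace p n →ₗ[ℝ] (Fin n → Fin (p + 1) → ℝ) :=
    { toFun := fun u i j => (u : ℝ → ℝ) (pt i j)
      map_add' := fun u v => rfl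
      map_smul' := fun c u => rfl }
  refine Module.Finite.of_injective E ((injective_iff_map_eq_zero E).2 fun u hu => ?_)
  refine SplineSpace.eq_zero_of_ae u ?_
  filter_upwards [ae_exists_cell (n := n)] with x hx
  obtain ⟨i, hi, hx⟩ := hx
  obtain ⟨q, hqd, hq⟩ := u.2.2.2 i hi
  have hq0 : q = 0 := by
    refine Polynomial.eq_zero_of_natDegree_lt_card_of_eval_eq_zero q (f := pt ⟨i, hi⟩) ?_ ?_ ?_
    · intro j k hjk
      simp only [pt, div_left_inj' hn.ne', add_right_inj,
        div_left_inj' (show (p : ℝ) + 2 ≠ 0 by positivity), add_left_inj] at hjk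
      exact Fin.ext (by exact_mod_cast hjk)
    · intro j
      rw [← hq]
      · exact congrFun (congrFun hu ⟨i, hi⟩) j
      · have hj : (j : ℝ) ≤ p := by exact_mod_cast Nat.lt_succ_iff.1 j.2
        have h1 : 0 < ((j : ℝ) + 1) / ((p : ℝ) + 2) := by positivity
        have h2 : ((j : ℝ) + 1) / ((p : ℝ) + 2) < 1 := by
          rw [div_lt_one (by positivity)]; linarith
        exact ⟨div_lt_div_of_pos_right (by simpa using h1) hn,
          div_lt_div_of_pos_right (by simpa using h2) hn⟩
    · simpa using Nat.lt_succ_of_le hqd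
  rw [hq x hx, hq0]; simp

theorem energyForm_isCompl (W : Submodule ℝ (SplineSpace p n)) :
    IsCompl W ((energyForm p n).orthogonal W) := by
  have hsymm : (energyForm p n).IsSymm := ⟨fun u v => by
    simp only [energyForm_apply, mul_comm]⟩
  rw [LinearMap.BilinForm.isCompl_orthogonal_iff_disjoint hsymm.isRefl, Submodule.disjoint_def]
  exact fun u hu hv => eq_zero_of_energyForm_self u (hv u hu)

/-- The `A`-orthogonal projector of the spline space onto a subspace `W`: the projection onto `W`
along the orthogonal complement of `W` with respect to the energy scalar product. -/
def energyProjector (W : Submodule ℝ (SplineSpace p n)) :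
    SplineSpace p n →ₗ[ℝ] SplineSpace p n :=
  W.projection ((energyForm p n).orthogonal W) (energyForm_isCompl W)

end Forms

/-! ### The multigrid method in matrix-vector form -/

section Multigrid

/-- `‖v‖_Q = (Q v, v)^(1/2)` for a symmetric positive definite matrix `Q`. -/
def matrixNorm {ι : Type*} [Fintype ι] (Q : Matrix ι ι ℝ) (v : ι → ℝ) : ℝ :=
  √((Q *ᵥ v) ⬝ᵥ v)

/-- `ν` smoothing steps `u ← u + τ L⁻¹ (f - A u)`. -/
def smoothing {ι : Type*} [Fintype ι] [DecidableEq ι] (A L : Matrix ι ι ℝ) (τ : ℝ) (ν : ℕ)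
    (f u : ι → ℝ) : ι → ℝ :=
  (fun w => w + τ • (L⁻¹ *ᵥ (f - A *ᵥ w)))^[ν] u

/-- One step of the two-grid method for `A u = f`: `ν` smoothing steps followed by the exact
coarse-grid correction with coarse-grid matrix `Ac`, prolongation `P` and restriction `Pᵀ`. -/
def twoGridStep {ι κ : Type*} [Fintype ι] [DecidableEq ι] [Fintype κ] [DecidableEq κ]
    (A L : Matrix ι ι ℝ) (Ac : Matrix κ κ ℝ) (P : Matrix ι κ ℝ) (τ : ℝ) (ν : ℕ)
    (f u : ι → ℝ) : ι → ℝ :=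
  let w := smoothing A L τ ν f u
  w + P *ᵥ (Ac⁻¹ *ᵥ (Pᵀ *ᵥ (f - A *ᵥ w)))

/-- One step of the symmetric W-cycle on level `ℓ` for `A ℓ u = f`: `m` pre-smoothing steps, a
coarse-grid correction obtained by applying two steps of the W-cycle on the next coarser level to
the coarse-grid problem with starting value zero, and `m` post-smoothing steps. On level `0` the
problem is solved exactly. -/
def wCycleStep {ι : ℕ → Type*} [∀ ℓ, Fintype (ι ℓ)] [∀ ℓ, DecidableEq (ι ℓ)]
    (A L : ∀ ℓ, Matrix (ι ℓ) (ι ℓ) ℝ) (P : ∀ ℓ, Matrix (ι (ℓ + 1)) (ι ℓ) ℝ) (τ : ℝ) (m : ℕ) :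
    ∀ ℓ, (ι ℓ → ℝ) → (ι ℓ → ℝ) → (ι ℓ → ℝ)
  | 0, f, _ => (A 0)⁻¹ *ᵥ f
  | ℓ + 1, f, u =>
    let w := smoothing (A (ℓ + 1)) (L (ℓ + 1)) τ m f u
    let r := (P ℓ)ᵀ *ᵥ (f - A (ℓ + 1) *ᵥ w)
    let c := wCycleStep A L P τ m ℓ r (wCycleStep A L P τ m ℓ r 0)
    smoothing (A (ℓ + 1)) (L (ℓ + 1)) τ m f (w + P ℓ *ᵥ c)

end Multigrid

/-! ### The matrices of the spline discretization -/

section Matrices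

variable {p n : ℕ} [NeZero n] {ι : Type*} [Fintype ι] [DecidableEq ι]

/-- The mass matrix `M` with respect to a basis of the spline space. -/
def massMatrix (b : Module.Basis ι ℝ (SplineSpace p n)) : Matrix ι ι ℝ :=
  Matrix.of fun i j => massForm p n (b i) (b j)

/-- The stiffness matrix `A` with respect to a basis of the spline space. -/
def stiffnessMatrix (b : Module.Basis ι ℝ (SplineSpace p n)) : Matrix ι ι ℝ :=
  Matrix.of fun i j => energyForm p n (b i) (b j)

/-- The boundary-corrected mass-Richardson smoother
`L = h⁻² M + (I - T)ᵀ A (I - T)` with `h = 1 / n`, where `T` is the matrix of the `A`-orthogonal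
projector onto the subspace `W`. -/
def smootherMatrix (b : Module.Basis ι ℝ (SplineSpace p n)) (W : Submodule ℝ (SplineSpace p n)) :
    Matrix ι ι ℝ :=
  let T : Matrix ι ι ℝ := LinearMap.toMatrix b b (energyProjector W)
  ((1 / (n : ℝ)) ^ 2)⁻¹ • massMatrix b + (1 - T)ᵀ * stiffnessMatrix b * (1 - T)

/-- The prolongation matrix from level `ℓ` to level `ℓ + 1`, representing the canonical embedding
of the spline space on the coarser grid into the one on the finer grid. -/
def prolongationMatrix {p n₀ ℓ : ℕ} {ι κ : Type*} [Fintype κ] [DecidableEq κ] [Fintype ι]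
    (bc : Module.Basis κ ℝ (SplineSpace p (n₀ * 2 ^ ℓ)))
    (bf : Module.Basis ι ℝ (SplineSpace p (n₀ * 2 ^ (ℓ + 1)))) : Matrix ι κ ℝ :=
  LinearMap.toMatrix bc bf (Submodule.inclusion (SplineSpace.le_succ p n₀ ℓ))

end Matrices

end

/-! The theorem rests on two form inequalities with absolute constants: `A ≤ 13 L` on the whole
spline space, and `L ≤ 12 A` on the energy-orthogonal complement of the coarse space. They give `τ =
1/13` and `ν₀ = 12 * 13`; smoothing property and approximation property then combine in the
classical way.

Multigrid part. `S = I - τ L⁻¹ A` is self-adjoint for `L` with spectrum in `[0,1]`, hence `(I - S)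
S^m` has `L`-norm at most `1 / (m + 1)`. Instead of the spectral theorem,
`IsSmoother.completely_monotone` shows that `j ↦ (L S^j x, x)` is completely monotone, and
`second_difference_le` bounds the second differences of such a sequence. The coarse-grid correction
`E` is an energy-orthogonal projection, so `τ ‖E w‖_A² = (L (I - S) w, E w)`; Cauchy-Schwarz and the
approximation property give the two-grid rate. For the symmetric cycle the energy rate is `σ = ν₀ /
(ν + 1)`, and the W-cycle recursion `q ↦ σ + q²` preserves `q ≤ 2σ` once `σ ≤ 1/4`.

`A ≤ 13 L` (`energyForm_le_smootherForm`). For `t = T u`, Pythagoras leaves `‖t‖_A² = (t, u)_A` to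
be bounded, and for `p ≥ 2` this equals `-(t'', u) + (t, u)` because `t'` vanishes at the boundary.
The inverse inequality `‖t''‖ ≤ √12 n ‖t'‖` finishes the bound. Its constant does not depend on `p`:
`‖f'‖² = -(f, f'')` carries the constant for `f'` over to `f`, and the induction ends at piecewise
linear functions, where it is explicit.

`L ≤ 12 A` (`smootherForm_le_energyForm`). A function orthogonal to the splines of degree `p` has a
primitive of norm at most `h` times its own; integration by parts again reduces the degree, down to
piecewise constants. If `e` is energy-orthogonal to the coarse splines of degree `p + 1`, this
applies to `e' - ∫₀ˣ e`, and a duality computation yields `‖e‖² ≤ (8/3) h² ‖e‖_A²`. -/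

noncomputable section

/-! ### Smoothing and approximation property imply multigrid convergence -/

section Abstract

variable {V : Type*} [AddCommGroup V] [Module ℝ V]

/-- Cauchy-Schwarz inequality for a positive semidefinite symmetric form. -/
theorem bilin_sq_le {a : LinearMap.BilinForm ℝ V} (hs : ∀ x y, a x y = a y x)
    (hn : ∀ x, 0 ≤ a x x) (x y : V) : a x y ^ 2 ≤ a x x * a y y := by
  have h := LinearMap.BilinForm.apply_mul_apply_le_of_forall_zero_le a hn x y
  rwa [hs y x, ← sq] at h

theorem sqrt_bilin_add_le {a : LinearMap.BilinForm ℝ V} (hs : ∀ x y, a x y = a y x)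
    (hn : ∀ x, 0 ≤ a x x) (x y : V) : √(a (x + y) (x + y)) ≤ √(a x x) + √(a y y) := by
  have h1 : a x y ≤ √(a x x) * √(a y y) := by
    rw [← Real.sqrt_mul (hn x)]
    exact Real.le_sqrt_of_sq_le (bilin_sq_le hs hn x y)
  rw [Real.sqrt_le_left (by positivity)]
  have h2 := Real.sq_sqrt (hn x)
  have h3 := Real.sq_sqrt (hn y)
  have h4 : a (x + y) (x + y) = a x x + 2 * a x y + a y y := by
    simp only [map_add, LinearMap.add_apply, hs y x]; ring
  nlinarith

/-- A convex decreasing nonnegative sequence whose second differences decrease has small second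
differences. -/
theorem second_difference_le {f g k : ℕ → ℝ} (hf : ∀ j, 0 ≤ f j) (hg : ∀ j, 0 ≤ g j)
    (hfg : ∀ j, g j = f j - f (j + 1)) (hgk : ∀ j, k j = g j - g (j + 1))
    (hk : ∀ j, k (j + 1) ≤ k j) (m : ℕ) :
    ((m : ℝ) + 1) * k m ≤ g 0 ∧ ((m : ℝ) + 1) * (m + 2) / 2 * k m ≤ f 0 := by
  -- Telescoping: each of the `m + 1` drops `g j - g (j + 1) = k j` with `j ≤ m` is at least `k m`.
  have h1 : ((m : ℝ) + 1) * k m + g (m + 1) ≤ g 0 := by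
    induction m with
    | zero => simp [hgk 0]
    | succ m ih =>
      have := mul_le_mul_of_nonneg_left (hk m) (show (0 : ℝ) ≤ m + 1 by positivity)
      push_cast
      linarith [hgk (m + 1)]
  -- Telescoping twice: `g j ≥ (m + 1 - j) * k m + g (m + 1)`, and the weights `m + 1 - j` for `j ≤
  -- m` add up to `(m + 1) (m + 2) / 2`.
  have h2 : ((m : ℝ) + 1) * (m + 2) / 2 * k m + (m + 1) * g (m + 1) + f (m + 1) ≤ f 0 := by
    clear h1
    induction m with
    | zero => simp; linarith [hgk 0, hfg 0]
    | succ m ih =>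
      have := mul_le_mul_of_nonneg_left (hk m)
        (show (0 : ℝ) ≤ ((m : ℝ) + 1) * (m + 2) / 2 by positivity)
      have e : g (m + 1) = k (m + 1) + g (m + 1 + 1) := by linarith [hgk (m + 1)]
      have e' : f (m + 1) = k (m + 1) + g (m + 1 + 1) + f (m + 1 + 1) := by
        linarith [hfg (m + 1)]
      rw [e, e'] at ih
      push_cast
      linarith
  refine ⟨by linarith [hg (m + 1)], ?_⟩
  have : 0 ≤ ((m : ℝ) + 1) * g (m + 1) := mul_nonneg (by positivity) (hg _)
  linarith [hf (m + 1)]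

/-- `S` is the iteration operator `I - τ L⁻¹ A` of a damped stationary iteration with
`0 ≤ τ A ≤ L`, for the forms `l` and `a` of `L` and `A`. -/
structure IsSmoother (l a : LinearMap.BilinForm ℝ V) (S : Module.End ℝ V) (τ : ℝ) : Prop where
  symm_l : ∀ x y, l x y = l y x
  symm_a : ∀ x y, a x y = a y x
  pos : 0 < τ
  nonneg_a : ∀ x, 0 ≤ a x x
  le : ∀ x, τ * a x x ≤ l x x
  eq : ∀ x y, l ((1 - S) x) y = τ * a x y

namespace IsSmoother

variable {l a : LinearMap.BilinForm ℝ V} {S : Module.End ℝ V} {τ : ℝ}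

theorem nonneg_l (h : IsSmoother l a S τ) (x : V) : 0 ≤ l x x :=
  (mul_nonneg h.pos.le (h.nonneg_a x)).trans (h.le x)

theorem symm_one_sub (h : IsSmoother l a S τ) (x y : V) :
    l ((1 - S) x) y = l x ((1 - S) y) := by
  rw [h.eq, h.symm_l x, h.eq, h.symm_a]

theorem symm_S (h : IsSmoother l a S τ) (x y : V) : l (S x) y = l x (S y) := by
  have := h.symm_one_sub x y
  simp only [LinearMap.sub_apply, Module.End.one_apply, map_sub] at this
  linarith

theorem symm_S_pow (h : IsSmoother l a S τ) (m : ℕ) (x y : V) :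
    l ((S ^ m) x) y = l x ((S ^ m) y) := by
  induction m generalizing x y with
  | zero => rfl
  | succ m ih =>
    rw [pow_succ, Module.End.mul_apply, ih, h.symm_S, ← Module.End.mul_apply, ← pow_succ', pow_succ]

theorem commute_pow_one_sub (S : Module.End ℝ V) (m : ℕ) : Commute (S ^ m) (1 - S) :=
  ((Commute.one_right S).sub_right (Commute.refl S)).pow_left m

theorem energy_symm_S_pow (h : IsSmoother l a S τ) (m : ℕ) (x y : V) :
    a ((S ^ m) x) y = a x ((S ^ m) y) := by
  have e : (1 - S) * S ^ m = S ^ m * (1 - S) := (commute_pow_one_sub S m).eq.symm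
  refine mul_left_cancel₀ h.pos.ne' ?_
  rw [← h.eq, ← h.eq, ← h.symm_S_pow, ← Module.End.mul_apply, e, Module.End.mul_apply]

/-- All mixed differences of `j ↦ l (S ^ j x) x` have the sign of a completely monotone
sequence. -/
theorem completely_monotone (h : IsSmoother l a S τ) (i j : ℕ) (x : V) :
    0 ≤ l (((1 - S) ^ i * S ^ j) x) x := by
  -- By self-adjointness a pair of equal factors can be moved onto the argument, one to each side of
  -- the form. This reduces both exponents to `0` or `1`.
  have e1 : ∀ i j, (1 - S) ^ (i + 2) * S ^ j = (1 - S) * ((1 - S) ^ i * S ^ j) * (1 - S) := by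
    intro i j
    rw [mul_assoc, mul_assoc, (commute_pow_one_sub S j).eq, ← mul_assoc, ← mul_assoc, ← pow_succ',
      ← pow_succ]
  have e2 : ∀ i j, (1 - S) ^ i * S ^ (j + 2) = S * ((1 - S) ^ i * S ^ j) * S := by
    intro i j
    have : Commute S ((1 - S) ^ i) := ((Commute.one_right S).sub_right (Commute.refl S)).pow_right i
    rw [← mul_assoc S, this.eq, mul_assoc, mul_assoc, ← pow_succ, ← pow_succ']
  have hS1 : ∀ z, 0 ≤ l ((1 - S) z) z := fun z => by
    rw [h.eq]; exact mul_nonneg h.pos.le (h.nonneg_a z)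
  have hS0 : ∀ z, 0 ≤ l (S z) z := fun z => by
    have := h.le z
    rw [← h.eq] at this
    simp only [LinearMap.sub_apply, Module.End.one_apply, map_sub] at this
    linarith
  have hS : ∀ z, 0 ≤ l (((1 - S) * S) z) z := fun z => by
    have h1 := hS0 ((1 - S) z)
    have h2 := hS1 (S z)
    rw [← h.symm_one_sub] at h1
    -- The mixed case is not a congruence of a nonnegative operator, but it is the sum of two: `S`
    -- conjugated by `1 - S`, and `1 - S` conjugated by `S`.
    have e : (1 - S) * S = (1 - S) * S * (1 - S) + S * (1 - S) * S := by noncomm_ring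
    rw [e]
    simp only [LinearMap.add_apply, Module.End.mul_apply, map_add]
    rw [h.symm_S ((1 - S) (S z))]
    exact add_nonneg h1 h2
  induction i using Nat.twoStepInduction generalizing j x with
  | zero =>
    induction j using Nat.twoStepInduction generalizing x with
    | zero => simpa using h.nonneg_l x
    | one => simpa using hS0 x
    | more j ih _ => rw [e2, mul_assoc, Module.End.mul_apply, h.symm_S]; exact ih (S x)
  | one =>
    induction j using Nat.twoStepInduction generalizing x with
    | zero => simpa using hS1 x
    | one => simpa using hS x
    | more j ih _ => rw [e2, mul_assoc, Module.End.mul_apply, h.symm_S]; exact ih (S x)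
  | more i ih _ =>
    rw [e1, mul_assoc, Module.End.mul_apply, h.symm_one_sub]; exact ih j ((1 - S) x)

/-- `second_difference_le` for `f j = l (S ^ j x) x`: the factors `1 - S` and `(1 - S) ^ 2` produce
its first and second differences, `completely_monotone` with `i = 3` makes the latter decrease, and
the initial values are `f 0 = l x x` and `g 0 = τ * a x x`. -/
theorem smoothing_aux (h : IsSmoother l a S τ) (m : ℕ) (x : V) :
    ((m : ℝ) + 1) * l (((1 - S) ^ 2 * S ^ m : Module.End ℝ V) x) x ≤ τ * a x x ∧
    ((m : ℝ) + 1) * (m + 2) / 2 * l (((1 - S) ^ 2 * S ^ m : Module.End ℝ V) x) x ≤ l x x := by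
  have key := second_difference_le (f := fun j => l ((S ^ j) x) x)
    (g := fun j => l (((1 - S) * S ^ j) x) x) (k := fun j => l (((1 - S) ^ 2 * S ^ j : Module.End ℝ V) x) x)
    (fun j => by simpa using h.completely_monotone 0 j x)
    (fun j => by simpa using h.completely_monotone 1 j x)
    (fun j => by
      rw [sub_mul, one_mul, ← pow_succ']
      simp only [LinearMap.sub_apply, map_sub])
    (fun j => by
      have e : (1 - S) ^ 2 * S ^ j = (1 - S) * S ^ j - (1 - S) * S ^ (j + 1) := by
        rw [pow_succ' S]; noncomm_ring
      rw [e]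
      simp only [LinearMap.sub_apply, map_sub])
    (fun j => by
      have e : (1 - S) ^ 3 * S ^ j = (1 - S) ^ 2 * S ^ j - (1 - S) ^ 2 * S ^ (j + 1) := by
        rw [pow_succ' S, pow_succ (1 - S)]; noncomm_ring
      have := h.completely_monotone 3 j x
      rw [e] at this
      simp only [LinearMap.sub_apply, map_sub] at this
      linarith) m
  have e0 : l x x - l (S x) x = τ * a x x := by rw [← h.eq]; simp
  simpa [e0] using key

theorem residual_eq (h : IsSmoother l a S τ) (m : ℕ) (x : V) :
    l ((1 - S) ((S ^ m) x)) ((1 - S) ((S ^ m) x)) = l (((1 - S) ^ 2 * S ^ (2 * m) : Module.End ℝ V) x) x := by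
  have e : (1 - S) ^ 2 * S ^ (2 * m) = S ^ m * ((1 - S) * ((1 - S) * S ^ m)) := by
    have hc := (commute_pow_one_sub S m).eq
    rw [two_mul, pow_add, ← mul_assoc, ← mul_assoc, ← mul_assoc, hc, mul_assoc (1 - S) (S ^ m), hc,
      sq, mul_assoc (1 - S) (1 - S)]
  rw [e]
  simp only [Module.End.mul_apply]
  rw [h.symm_S_pow m ((1 - S) ((1 - S) ((S ^ m) x))), h.symm_one_sub ((1 - S) ((S ^ m) x))]

/-- The smoothing property in the norm of the smoother. -/
theorem smoothing_property (h : IsSmoother l a S τ) (m : ℕ) (x : V) :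
    ((m : ℝ) + 1) ^ 2 * l ((1 - S) ((S ^ m) x)) ((1 - S) ((S ^ m) x)) ≤ l x x := by
  have h1 := (h.smoothing_aux (2 * m) x).2
  rw [← h.residual_eq] at h1
  have h2 := h.nonneg_l ((1 - S) ((S ^ m) x))
  -- With `2 * m` in place of `m` the factor is `(2m + 1) (2m + 2) / 2 = (2m + 1) (m + 1) ≥ (m +
  -- 1)²`.
  refine le_trans (mul_le_mul_of_nonneg_right ?_ h2) h1
  have : (0 : ℝ) ≤ m := m.cast_nonneg
  push_cast
  nlinarith

/-- The smoothing property in the energy norm. -/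
theorem smoothing_property_energy (h : IsSmoother l a S τ) (m : ℕ) (x : V) :
    (2 * (m : ℝ) + 1) * l ((1 - S) ((S ^ m) x)) ((1 - S) ((S ^ m) x)) ≤ τ * a x x := by
  have h1 := (h.smoothing_aux (2 * m) x).1
  rw [← h.residual_eq] at h1
  push_cast at h1
  exact h1

/-- Smoothing never increases the energy: `(1 - S) (1 - S²) = (1 - S)² + (1 - S)² S`, and both
summands are nonnegative for `l`. -/
theorem energy_S_pow_le (h : IsSmoother l a S τ) (m : ℕ) (x : V) :
    a ((S ^ m) x) ((S ^ m) x) ≤ a x x := by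
  induction m with
  | zero => rfl
  | succ m ih =>
    refine le_trans ?_ ih
    rw [pow_succ', Module.End.mul_apply]
    generalize (S ^ m) x = y
    have h1 := h.completely_monotone 2 0 y
    have h2 := h.completely_monotone 2 1 y
    have h3 : a (S y) (S y) = a ((S ^ 2) y) y := by
      rw [sq, Module.End.mul_apply]
      simpa using (h.energy_symm_S_pow 1 (S y) y).symm
    have e : τ * (a y y - a ((S ^ 2) y) y) = l (((1 - S) ^ 2 * S ^ 0 : Module.End ℝ V) y) y +
        l (((1 - S) ^ 2 * S ^ 1 : Module.End ℝ V) y) y := by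
      have e' : (1 - S) ^ 2 * S ^ 0 + (1 - S) ^ 2 * S ^ 1 = (1 - S) - (1 - S) * S ^ 2 := by
        simp only [sq]; noncomm_ring
      rw [← LinearMap.add_apply, ← map_add, ← LinearMap.add_apply, e', mul_sub, ← h.eq, ← h.eq]
      simp only [Module.End.mul_apply, LinearMap.sub_apply, map_sub]
    have := nonneg_of_mul_nonneg_right (e ▸ add_nonneg h1 h2) h.pos
    linarith

/-- Convergence of the two-grid method in the norm of the smoother: `E` is the coarse-grid
correction, satisfying the approximation property. -/
theorem two_grid_convergence (h : IsSmoother l a S τ) {E : Module.End ℝ V} {K : ℝ}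
    (hE : ∀ x y, a (E x) (E y) = a x (E y)) (hK : ∀ x, l (E x) (E x) ≤ K * a (E x) (E x))
    (hK0 : 0 ≤ K) (m : ℕ) (x : V) :
    a (E ((S ^ m) x)) (E ((S ^ m) x)) ≤ K / τ ^ 2 * l ((1 - S) ((S ^ m) x)) ((1 - S) ((S ^ m) x)) ∧
    l (E ((S ^ m) x)) (E ((S ^ m) x)) ≤ (K / τ / (m + 1)) ^ 2 * l x x := by
  have hτ := h.pos
  have h4 := h.smoothing_property m x
  generalize (S ^ m) x = w at *
  -- The projection property turns the energy of `E w` into a pairing of the smoothed residual with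
  -- `E w`. After Cauchy-Schwarz, `hK` bounds the factor `l (E w) (E w)` by the energy, one power of
  -- which cancels.
  have h1 : τ * a (E w) (E w) = l ((1 - S) w) (E w) := by rw [hE, h.eq]
  have h2 := bilin_sq_le h.symm_l h.nonneg_l ((1 - S) w) (E w)
  have h3 := h.nonneg_l ((1 - S) w)
  have h5 := hK w
  generalize l ((1 - S) w) ((1 - S) w) = d at *
  rw [← h1] at h2
  have h6 := h.nonneg_a (E w)
  generalize a (E w) (E w) = q at *
  have h7 : q ≤ K / τ ^ 2 * d := by
    rcases h6.eq_or_lt with rfl | h6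
    · positivity
    · have h8 : (τ ^ 2 * q) * q ≤ (K * d) * q := by nlinarith
      have h9 := le_of_mul_le_mul_right h8 h6
      rw [div_mul_eq_mul_div, le_div_iff₀ (by positivity)]
      linarith
  refine ⟨h7, ?_⟩
  calc l (E w) (E w) ≤ K * (K / τ ^ 2 * d) := h5.trans (mul_le_mul_of_nonneg_left h7 hK0)
    _ = (K / τ / (m + 1)) ^ 2 * (((m : ℝ) + 1) ^ 2 * d) := by field_simp
    _ ≤ _ := mul_le_mul_of_nonneg_left h4 (by positivity)

/-- One-sided smoothing gains the factor `1 / (2m + 1)` only for the squared energy norm. The other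
half of the symmetric rate comes from the energy-adjoint `S ^ m E`. -/
theorem two_grid_energy (h : IsSmoother l a S τ) {E : Module.End ℝ V} {K : ℝ}
    (hE : ∀ x y, a (E x) (E y) = a x (E y)) (hK : ∀ x, l (E x) (E x) ≤ K * a (E x) (E x))
    (hK0 : 0 ≤ K) (m : ℕ) (x : V) :
    a (E ((S ^ m) x)) (E ((S ^ m) x)) ≤ K / τ / (2 * m + 1) * a x x := by
  have hτ := h.pos
  calc _ ≤ K / τ ^ 2 * l ((1 - S) ((S ^ m) x)) ((1 - S) ((S ^ m) x)) :=
        (h.two_grid_convergence hE hK hK0 m x).1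
    _ = K / τ ^ 2 / (2 * m + 1) *
        ((2 * (m : ℝ) + 1) * l ((1 - S) ((S ^ m) x)) ((1 - S) ((S ^ m) x))) := by field_simp
    _ ≤ K / τ ^ 2 / (2 * m + 1) * (τ * a x x) :=
        mul_le_mul_of_nonneg_left (h.smoothing_property_energy m x) (by positivity)
    _ = _ := by field_simp

/-- Convergence of the symmetric two-grid method in the energy norm. -/
theorem symmetric_two_grid_energy (h : IsSmoother l a S τ) {E : Module.End ℝ V} {K : ℝ}
    (hE : ∀ x y, a (E x) (E y) = a x (E y)) (hK : ∀ x, l (E x) (E x) ≤ K * a (E x) (E x))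
    (hK0 : 0 ≤ K) (m : ℕ) (x : V) :
    a ((S ^ m) (E ((S ^ m) x))) ((S ^ m) (E ((S ^ m) x))) ≤ (K / τ / (2 * m + 1)) ^ 2 * a x x := by
  have hτ := h.pos
  have h1 := h.two_grid_energy hE hK hK0 m x
  have hσ : 0 ≤ K / τ / (2 * m + 1) := by positivity
  set σ := K / τ / (2 * m + 1) with hσd
  set y := E ((S ^ m) x)
  set z := (S ^ m) y with hz
  -- Duality: moving `S ^ m` and `E` to the other side makes the one-sided bound applicable to `z`
  -- too, so both factors of Cauchy-Schwarz contribute `σ`.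
  have h2 : a z z = a y (E ((S ^ m) z)) := by
    rw [hz, h.energy_symm_S_pow m y, ← hz, h.symm_a y, ← hE, h.symm_a]
  have h3 := bilin_sq_le h.symm_a h.nonneg_a y (E ((S ^ m) z))
  rw [← h2] at h3
  have h4 := h.two_grid_energy hE hK hK0 m z
  rw [← hσd] at h4
  have h5 : a z z ^ 2 ≤ (σ ^ 2 * a x x) * a z z := by
    calc _ ≤ _ := h3
      _ ≤ (σ * a x x) * (σ * a z z) := mul_le_mul h1 h4 (h.nonneg_a _)
        (mul_nonneg hσ (h.nonneg_a _))
      _ = _ := by ring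
  rcases (h.nonneg_a z).eq_or_lt with h6 | h6
  · rw [← h6]; exact mul_nonneg (by positivity) (h.nonneg_a _)
  · rw [sq] at h5
    exact le_of_mul_le_mul_right h5 h6

end IsSmoother
end Abstract


/-! ### Error propagation of the two-grid method and the W-cycle in matrix form -/

section MatrixConvergence

variable {ι κ : Type*} [Fintype ι] [DecidableEq ι] [Fintype κ] [DecidableEq κ]

theorem matrixNorm_eq (Q : Matrix ι ι ℝ) (v : ι → ℝ) :
    matrixNorm Q v = √(Matrix.toBilin' Q v v) := by
  rw [matrixNorm, Matrix.toBilin'_apply', dotProduct_comm]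

theorem toBilin'_symm {Q : Matrix ι ι ℝ} (hQ : Q.PosDef) (x y : ι → ℝ) :
    Matrix.toBilin' Q x y = Matrix.toBilin' Q y x := by
  have hT : Qᵀ = Q := by simpa using hQ.1.eq
  rw [Matrix.toBilin'_apply', Matrix.toBilin'_apply', Matrix.dotProduct_mulVec,
    ← Matrix.mulVec_transpose, hT, dotProduct_comm]

theorem toBilin'_self_nonneg {Q : Matrix ι ι ℝ} (hQ : Q.PosDef) (x : ι → ℝ) :
    0 ≤ Matrix.toBilin' Q x x := by
  rw [Matrix.toBilin'_apply']
  simpa using hQ.posSemidef.dotProduct_mulVec_nonneg x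

/-- The iteration operator `I - τ L⁻¹ A` of the smoother. -/
def smootherIteration (A L : Matrix ι ι ℝ) (τ : ℝ) : Module.End ℝ (ι → ℝ) :=
  Matrix.toLin' (1 - τ • (L⁻¹ * A))

/-- The iteration operator `I - P Ac⁻¹ Pᵀ A` of the coarse-grid correction. -/
def coarseGridCorrection (A : Matrix ι ι ℝ) (Ac : Matrix κ κ ℝ) (P : Matrix ι κ ℝ) :
    Module.End ℝ (ι → ℝ) :=
  Matrix.toLin' (1 - P * (Ac⁻¹ * (Pᵀ * A)))

theorem isSmoother_smootherIteration {A L : Matrix ι ι ℝ} (hA : A.PosDef) (hL : L.PosDef) {τ : ℝ}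
    (hτ : 0 < τ) (hAL : ∀ v, τ * Matrix.toBilin' A v v ≤ Matrix.toBilin' L v v) :
    IsSmoother (Matrix.toBilin' L) (Matrix.toBilin' A) (smootherIteration A L τ) τ where
  symm_l := toBilin'_symm hL
  symm_a := toBilin'_symm hA
  pos := hτ
  nonneg_a := toBilin'_self_nonneg hA
  le := hAL
  eq x y := by
    have hu : IsUnit L.det := (Matrix.isUnit_iff_isUnit_det L).1 hL.isUnit
    rw [toBilin'_symm hL, toBilin'_symm hA, Matrix.toBilin'_apply', Matrix.toBilin'_apply']
    have e : (1 - smootherIteration A L τ) x = τ • (L⁻¹ *ᵥ (A *ᵥ x)) := by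
      simp [smootherIteration, Matrix.mulVec_mulVec]
    rw [e, Matrix.mulVec_smul, Matrix.mulVec_mulVec, Matrix.mul_nonsing_inv _ hu, Matrix.one_mulVec,
      dotProduct_smul, smul_eq_mul]

theorem sub_smoothing {A L : Matrix ι ι ℝ} {τ : ℝ} (m : ℕ) (uex u : ι → ℝ) :
    uex - smoothing A L τ m (A *ᵥ uex) u = (smootherIteration A L τ ^ m) (uex - u) := by
  induction m with
  | zero => rfl
  | succ m ih =>
    rw [pow_succ', Module.End.mul_apply, ← ih]
    simp only [smoothing, Function.iterate_succ_apply']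
    generalize (fun w => w + τ • (L⁻¹ *ᵥ (A *ᵥ uex - A *ᵥ w)))^[m] u = w
    rw [← Matrix.mulVec_sub]
    simp only [smootherIteration, Matrix.toLin'_apply, Matrix.sub_mulVec, Matrix.one_mulVec,
      Matrix.smul_mulVec, Matrix.mulVec_mulVec]
    abel

theorem coarseGridCorrection_apply (A : Matrix ι ι ℝ) (Ac : Matrix κ κ ℝ) (P : Matrix ι κ ℝ)
    (x : ι → ℝ) :
    coarseGridCorrection A Ac P x = x - P *ᵥ (Ac⁻¹ *ᵥ (Pᵀ *ᵥ (A *ᵥ x))) := by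
  simp [coarseGridCorrection, Matrix.mulVec_mulVec]

variable {A L : Matrix ι ι ℝ} {Ac : Matrix κ κ ℝ} {P : Matrix ι κ ℝ}

/-- Galerkin orthogonality: `Pᵀ A E x = Pᵀ A x - Ac Ac⁻¹ Pᵀ A x = 0`. -/
theorem toBilin'_prolongation_correction (hAc : Ac.PosDef) (hG : Pᵀ * A * P = Ac) (c : κ → ℝ)
    (x : ι → ℝ) : Matrix.toBilin' A (P *ᵥ c) (coarseGridCorrection A Ac P x) = 0 := by
  have hu : IsUnit Ac.det := (Matrix.isUnit_iff_isUnit_det Ac).1 hAc.isUnit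
  rw [coarseGridCorrection_apply, Matrix.toBilin'_apply', dotProduct_comm,
    Matrix.dotProduct_mulVec, ← Matrix.mulVec_transpose, Matrix.mulVec_sub, Matrix.mulVec_sub,
    Matrix.mulVec_mulVec _ A P, Matrix.mulVec_mulVec _ Pᵀ (A * P), ← Matrix.mul_assoc, hG,
    Matrix.mulVec_mulVec _ Ac Ac⁻¹, Matrix.mul_nonsing_inv _ hu, Matrix.one_mulVec, sub_self,
    zero_dotProduct]

/-- `E x` differs from `x` by an element of the range of `P`, which is energy-orthogonal to `E y`.
-/
theorem toBilin'_correction (hAc : Ac.PosDef) (hG : Pᵀ * A * P = Ac) (x y : ι → ℝ) :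
    Matrix.toBilin' A (coarseGridCorrection A Ac P x) (coarseGridCorrection A Ac P y) =
      Matrix.toBilin' A x (coarseGridCorrection A Ac P y) := by
  nth_rw 1 [coarseGridCorrection_apply A Ac P x]
  rw [map_sub, LinearMap.sub_apply, toBilin'_prolongation_correction hAc hG, sub_zero]

theorem sub_twoGridStep {τ : ℝ} (m : ℕ) (uex u : ι → ℝ) :
    uex - twoGridStep A L Ac P τ m (A *ᵥ uex) u =
      coarseGridCorrection A Ac P ((smootherIteration A L τ ^ m) (uex - u)) := by
  rw [← sub_smoothing, coarseGridCorrection_apply, Matrix.mulVec_sub A]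
  simp only [twoGridStep]
  abel

/-- Convergence of the two-grid method from the bound `τ A ≤ L` and the approximation property. -/
theorem matrixNorm_sub_twoGridStep_le (hA : A.PosDef) (hL : L.PosDef) (hAc : Ac.PosDef)
    (hG : Pᵀ * A * P = Ac) {τ K : ℝ} (hτ : 0 < τ) (hK0 : 0 ≤ K)
    (hAL : ∀ v, τ * Matrix.toBilin' A v v ≤ Matrix.toBilin' L v v)
    (hK : ∀ e, (∀ c, Matrix.toBilin' A (P *ᵥ c) e = 0) →
      Matrix.toBilin' L e e ≤ K * Matrix.toBilin' A e e) (m : ℕ) (uex u : ι → ℝ) :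
    matrixNorm L (uex - twoGridStep A L Ac P τ m (A *ᵥ uex) u) ≤
      K / τ / (m + 1) * matrixNorm L (uex - u) := by
  have h := ((isSmoother_smootherIteration hA hL hτ hAL).two_grid_convergence
    (E := coarseGridCorrection A Ac P) (toBilin'_correction hAc hG)
    (fun x => hK _ fun c => toBilin'_prolongation_correction hAc hG c x) hK0 m (uex - u)).2
  rw [sub_twoGridStep, matrixNorm_eq, matrixNorm_eq]
  refine (Real.sqrt_le_sqrt h).trans_eq ?_
  rw [Real.sqrt_mul (by positivity), Real.sqrt_sq (by positivity)]

end MatrixConvergence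

/-- Convergence of the W-cycle from the bound `τ A ≤ L` and the approximation property. -/
theorem matrixNorm_sub_wCycleStep_le {ι : ℕ → Type*} [∀ ℓ, Fintype (ι ℓ)] [∀ ℓ, DecidableEq (ι ℓ)]
    {A L : ∀ ℓ, Matrix (ι ℓ) (ι ℓ) ℝ} {P : ∀ ℓ, Matrix (ι (ℓ + 1)) (ι ℓ) ℝ}
    (hA : ∀ ℓ, (A ℓ).PosDef) (hL : ∀ ℓ, (L ℓ).PosDef)
    (hG : ∀ ℓ, (P ℓ)ᵀ * A (ℓ + 1) * P ℓ = A ℓ) {τ K : ℝ} (hτ : 0 < τ) (hK0 : 0 ≤ K)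
    (hAL : ∀ ℓ v, τ * Matrix.toBilin' (A ℓ) v v ≤ Matrix.toBilin' (L ℓ) v v)
    (hK : ∀ ℓ e, (∀ c, Matrix.toBilin' (A (ℓ + 1)) (P ℓ *ᵥ c) e = 0) →
      Matrix.toBilin' (L (ℓ + 1)) e e ≤ K * Matrix.toBilin' (A (ℓ + 1)) e e) {m : ℕ}
    (hm : 4 * (K / τ) ≤ 2 * m + 1) (ℓ : ℕ) (uex u : ι ℓ → ℝ) :
    matrixNorm (A ℓ) (uex - wCycleStep A L P τ m ℓ (A ℓ *ᵥ uex) u) ≤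
      2 * (K / τ / (2 * m + 1)) * matrixNorm (A ℓ) (uex - u) := by
  have hσ : 0 ≤ K / τ / (2 * m + 1) := by positivity
  have hσ4 : K / τ / (2 * m + 1) ≤ 1 / 4 := by
    rw [div_le_iff₀ (by positivity)]; linarith
  induction ℓ with
  | zero =>
    have hu : IsUnit (A 0).det := (Matrix.isUnit_iff_isUnit_det _).1 (hA 0).isUnit
    have e : uex - wCycleStep A L P τ m 0 (A 0 *ᵥ uex) u = 0 := by
      rw [wCycleStep, Matrix.mulVec_mulVec, Matrix.nonsing_inv_mul _ hu, Matrix.one_mulVec,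
        sub_self]
    rw [e]
    have : matrixNorm (A 0) 0 = 0 := by simp [matrixNorm]
    rw [this]
    exact mul_nonneg (by positivity) (Real.sqrt_nonneg _)
  | succ ℓ ih =>
    have hS := isSmoother_smootherIteration (hA (ℓ + 1)) (hL (ℓ + 1)) hτ (hAL (ℓ + 1))
    have hE := toBilin'_correction (hA ℓ) (hG ℓ)
    have h1 := hS.symmetric_two_grid_energy hE
      (fun x => hK ℓ _ fun c => toBilin'_prolongation_correction (hA ℓ) (hG ℓ) c x) hK0 m (uex - u)
    have hu : IsUnit (A ℓ).det := (Matrix.isUnit_iff_isUnit_det _).1 (hA ℓ).isUnit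
    set σ := K / τ / (2 * m + 1)
    set S := smootherIteration (A (ℓ + 1)) (L (ℓ + 1)) τ
    set E := coarseGridCorrection (A (ℓ + 1)) (A ℓ) (P ℓ) with hEd
    set w := smoothing (A (ℓ + 1)) (L (ℓ + 1)) τ m (A (ℓ + 1) *ᵥ uex) u with hw
    have hd : uex - w = (S ^ m) (uex - u) := sub_smoothing m uex u
    set d := (S ^ m) (uex - u) with hdd
    -- The exact solution of the coarse problem, to which the two inner cycles compute the
    -- approximation `c`.
    set cex := (A ℓ)⁻¹ *ᵥ ((P ℓ)ᵀ *ᵥ (A (ℓ + 1) *ᵥ d)) with hcex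
    have hr : (P ℓ)ᵀ *ᵥ (A (ℓ + 1) *ᵥ uex - A (ℓ + 1) *ᵥ w) = A ℓ *ᵥ cex := by
      rw [← Matrix.mulVec_sub, hd, hcex, Matrix.mulVec_mulVec _ (A ℓ),
        Matrix.mul_nonsing_inv _ hu, Matrix.one_mulVec]
    set c := wCycleStep A L P τ m ℓ (A ℓ *ᵥ cex) (wCycleStep A L P τ m ℓ (A ℓ *ᵥ cex) 0) with hc
    -- The W-cycle error is the symmetric two-grid error plus the smoothed prolongation of the
    -- coarse error `cex - c`.
    have e : uex - wCycleStep A L P τ m (ℓ + 1) (A (ℓ + 1) *ᵥ uex) u =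
        (S ^ m) (E d) + (S ^ m) (P ℓ *ᵥ (cex - c)) := by
      rw [wCycleStep]
      simp only [← hw]
      rw [hr, sub_smoothing, ← hc, ← map_add]
      congr 1
      rw [hEd, coarseGridCorrection_apply, ← hcex, ← hd, Matrix.mulVec_sub]
      abel
    have hP : ∀ v, Matrix.toBilin' (A (ℓ + 1)) (P ℓ *ᵥ v) (P ℓ *ᵥ v) = Matrix.toBilin' (A ℓ) v v := by
      intro v
      rw [← hG ℓ, Matrix.toBilin'_apply', Matrix.toBilin'_apply', Matrix.mulVec_mulVec,
        Matrix.mul_assoc, ← Matrix.mulVec_mulVec _ (P ℓ)ᵀ, Matrix.dotProduct_mulVec v,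
        Matrix.vecMul_transpose]
    -- `P cex = d - E d` is the energy projection of `d` onto the coarse space, so its energy is at
    -- most that of `d`, hence of the initial error.
    have hcd : matrixNorm (A ℓ) cex ≤ matrixNorm (A (ℓ + 1)) (uex - u) := by
      rw [matrixNorm_eq, matrixNorm_eq, ← hP]
      refine Real.sqrt_le_sqrt (le_trans ?_ (hS.energy_S_pow_le m (uex - u)))
      have e1 : P ℓ *ᵥ cex = d - E d := by
        rw [hEd, coarseGridCorrection_apply, ← hcex]; abel
      rw [e1, ← hdd]
      simp only [map_sub, LinearMap.sub_apply]
      rw [hE, hS.symm_a (E d) d]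
      have := hS.nonneg_a (E d)
      rw [hE] at this
      linarith
    have hcc : matrixNorm (A ℓ) (cex - c) ≤ (2 * σ) ^ 2 * matrixNorm (A (ℓ + 1)) (uex - u) := by
      calc _ ≤ 2 * σ * (2 * σ * matrixNorm (A ℓ) (cex - 0)) :=
            (ih cex _).trans (mul_le_mul_of_nonneg_left (ih cex 0) (by positivity))
        _ ≤ 2 * σ * (2 * σ * matrixNorm (A (ℓ + 1)) (uex - u)) := by
            rw [sub_zero]; gcongr
        _ = _ := by ring
    rw [e]
    have h2 : matrixNorm (A (ℓ + 1)) ((S ^ m) (E d)) ≤ σ * matrixNorm (A (ℓ + 1)) (uex - u) := by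
      rw [matrixNorm_eq, matrixNorm_eq]
      refine (Real.sqrt_le_sqrt h1).trans_eq ?_
      rw [Real.sqrt_mul (by positivity), Real.sqrt_sq hσ]
    have h3 : matrixNorm (A (ℓ + 1)) ((S ^ m) (P ℓ *ᵥ (cex - c))) ≤ matrixNorm (A ℓ) (cex - c) := by
      rw [matrixNorm_eq, matrixNorm_eq, ← hP]
      exact Real.sqrt_le_sqrt (hS.energy_S_pow_le m _)
    have h4 : matrixNorm (A (ℓ + 1)) ((S ^ m) (E d) + (S ^ m) (P ℓ *ᵥ (cex - c))) ≤
        matrixNorm (A (ℓ + 1)) ((S ^ m) (E d)) +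
          matrixNorm (A (ℓ + 1)) ((S ^ m) (P ℓ *ᵥ (cex - c))) := by
      simp only [matrixNorm_eq]
      exact sqrt_bilin_add_le hS.symm_a hS.nonneg_a _ _
    have h5 : 0 ≤ matrixNorm (A (ℓ + 1)) (uex - u) := Real.sqrt_nonneg _
    -- This is where `σ ≤ 1/4` is needed: the recursion closes as `σ + (2σ)² ≤ 2σ`.
    have h6 : (2 * σ) ^ 2 ≤ σ := by nlinarith
    nlinarith [mul_le_mul_of_nonneg_right h6 h5]

/-! ### Functions on `(0,1)` with countably many discontinuities -/

/-- Boundedness and continuity on `(0,1)` off a countable set. -/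
def BoundedPiecewise (f : ℝ → ℝ) : Prop :=
  ∃ s : Set ℝ, s.Countable ∧ ∃ C : ℝ, ∀ x ∈ Ioo (0 : ℝ) 1 \ s, ContinuousAt f x ∧ |f x| ≤ C

namespace BoundedPiecewise

variable {f g : ℝ → ℝ}

theorem add (hf : BoundedPiecewise f) (hg : BoundedPiecewise g) :
    BoundedPiecewise fun x => f x + g x := by
  obtain ⟨s, hs, C, hC⟩ := hf
  obtain ⟨t, ht, D, hD⟩ := hg
  refine ⟨s ∪ t, hs.union ht, C + D, fun x hx => ?_⟩
  have h1 := hC x ⟨hx.1, fun h => hx.2 (Or.inl h)⟩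
  have h2 := hD x ⟨hx.1, fun h => hx.2 (Or.inr h)⟩
  exact ⟨h1.1.add h2.1, (abs_add_le _ _).trans (add_le_add h1.2 h2.2)⟩

theorem mul (hf : BoundedPiecewise f) (hg : BoundedPiecewise g) :
    BoundedPiecewise fun x => f x * g x := by
  obtain ⟨s, hs, C, hC⟩ := hf
  obtain ⟨t, ht, D, hD⟩ := hg
  refine ⟨s ∪ t, hs.union ht, C * D, fun x hx => ?_⟩
  have h1 := hC x ⟨hx.1, fun h => hx.2 (Or.inl h)⟩
  have h2 := hD x ⟨hx.1, fun h => hx.2 (Or.inr h)⟩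
  refine ⟨h1.1.mul h2.1, ?_⟩
  rw [abs_mul]
  exact mul_le_mul h1.2 h2.2 (abs_nonneg _) ((abs_nonneg _).trans h1.2)

theorem const (c : ℝ) : BoundedPiecewise fun _ => c :=
  ⟨∅, countable_empty, |c|, fun _ _ => ⟨continuousAt_const, le_rfl⟩⟩

theorem neg (hf : BoundedPiecewise f) : BoundedPiecewise fun x => -f x := by
  simpa using (const (-1)).mul hf

theorem of_continuousOn (hf : ContinuousOn f (Icc 0 1)) : BoundedPiecewise f := by
  obtain ⟨C, hC⟩ := isCompact_Icc.exists_bound_of_continuousOn hf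
  exact ⟨∅, countable_empty, C, fun x hx =>
    ⟨hf.continuousAt (Icc_mem_nhds hx.1.1 hx.1.2), hC x (Ioo_subset_Icc_self hx.1)⟩⟩

theorem intervalIntegrable (hf : BoundedPiecewise f) : IntervalIntegrable f volume 0 1 := by
  obtain ⟨s, hs, C, hC⟩ := hf
  rw [intervalIntegrable_iff_integrableOn_Ioo_of_le zero_le_one]
  have hm : MeasurableSet (Ioo (0 : ℝ) 1 \ s) := measurableSet_Ioo.diff hs.measurableSet
  have h1 : IntegrableOn f (Ioo (0 : ℝ) 1 \ s) := by
    refine IntegrableOn.of_bound (C := C) ?_ ?_ ?_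
    · exact (measure_mono sdiff_subset).trans_lt measure_Ioo_lt_top
    · exact ContinuousOn.aestronglyMeasurable
        (fun x hx => (hC x hx).1.continuousWithinAt) hm
    · filter_upwards [ae_restrict_mem hm] with x hx using (hC x hx).2
  exact h1.congr_set_ae (sdiff_null_ae_eq_self (hs.measure_zero _)).symm

theorem intervalIntegrable_sub (hf : BoundedPiecewise f) {a b : ℝ} (ha : a ∈ Icc (0 : ℝ) 1)
    (hb : b ∈ Icc (0 : ℝ) 1) : IntervalIntegrable f volume a b := by
  refine hf.intervalIntegrable.mono_set ?_
  rw [uIcc_of_le zero_le_one]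
  exact uIcc_subset_Icc ha hb

end BoundedPiecewise

/-- `F` is continuous on `[0,1]` with derivative `f` off a countable set. -/
structure IsPiecewisePrimitive (F f : ℝ → ℝ) : Prop where
  continuousOn : ContinuousOn F (Icc 0 1)
  boundedPiecewise : BoundedPiecewise f
  hasDerivAt : ∃ s : Set ℝ, s.Countable ∧ ∀ x ∈ Ioo (0 : ℝ) 1 \ s, HasDerivAt F (f x) x

/-- The primitive `x ↦ ∫₀ˣ f`. -/
def primitive (f : ℝ → ℝ) (x : ℝ) : ℝ := ∫ t in (0 : ℝ)..x, f t

@[simp] theorem primitive_zero (f : ℝ → ℝ) : primitive f 0 = 0 := by simp [primitive]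

theorem BoundedPiecewise.hasDerivAt_primitive {f : ℝ → ℝ} (hf : BoundedPiecewise f) {x : ℝ}
    (hx : x ∈ Ioo (0 : ℝ) 1) (hc : ContinuousAt f x) : HasDerivAt (primitive f) (f x) x := by
  refine intervalIntegral.integral_hasDerivAt_right
    (hf.intervalIntegrable_sub (by simp) (Ioo_subset_Icc_self hx)) ?_ hc
  have h := hf.intervalIntegrable
  rw [intervalIntegrable_iff_integrableOn_Ioo_of_le zero_le_one] at h
  exact ⟨Ioo 0 1, isOpen_Ioo.mem_nhds hx, h.aestronglyMeasurable⟩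

theorem BoundedPiecewise.isPiecewisePrimitive {f : ℝ → ℝ} (hf : BoundedPiecewise f) :
    IsPiecewisePrimitive (primitive f) f where
  continuousOn := by
    have h := intervalIntegral.continuousOn_primitive_interval (a := 0) (b := 1) (f := f)
      (μ := volume) (by
        rw [uIcc_of_le zero_le_one]
        exact (intervalIntegrable_iff_integrableOn_Icc_of_le zero_le_one).1 hf.intervalIntegrable)
    rwa [uIcc_of_le zero_le_one] at h
  boundedPiecewise := hf
  hasDerivAt := by
    obtain ⟨s, hs, C, hC⟩ := id hf
    exact ⟨s, hs, fun x hx => hf.hasDerivAt_primitive hx.1 (hC x hx).1⟩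

theorem IsPiecewisePrimitive.bounded {F f : ℝ → ℝ} (h : IsPiecewisePrimitive F f) :
    BoundedPiecewise F := .of_continuousOn h.continuousOn

/-- Integration by parts. -/
theorem IsPiecewisePrimitive.integral_mul {F f G g : ℝ → ℝ} (hF : IsPiecewisePrimitive F f)
    (hG : IsPiecewisePrimitive G g) :
    ∫ x in (0 : ℝ)..1, F x * g x = F 1 * G 1 - F 0 * G 0 - ∫ x in (0 : ℝ)..1, f x * G x := by
  obtain ⟨s, hs, hs'⟩ := hF.hasDerivAt
  obtain ⟨t, ht, ht'⟩ := hG.hasDerivAt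
  have i1 := (hF.boundedPiecewise.mul hG.bounded).intervalIntegrable
  have i2 := (hF.bounded.mul hG.boundedPiecewise).intervalIntegrable
  have h := integral_eq_of_hasDerivAt_off_countable (a := 0) (b := 1) (fun x => F x * G x)
    (fun x => f x * G x + F x * g x) (hs.union ht)
    (by rw [uIcc_of_le zero_le_one]; exact hF.continuousOn.mul hG.continuousOn)
    (fun x hx => by
      simp only [min_eq_left zero_le_one, max_eq_right zero_le_one] at hx
      exact (hs' x ⟨hx.1, fun h => hx.2 (Or.inl h)⟩).mul (ht' x ⟨hx.1, fun h => hx.2 (Or.inr h)⟩))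
    (i1.add i2)
  rw [intervalIntegral.integral_add i1 i2] at h
  linarith

/-- Cauchy-Schwarz inequality. -/
theorem BoundedPiecewise.sq_integral_mul_le {f g : ℝ → ℝ} (hf : BoundedPiecewise f)
    (hg : BoundedPiecewise g) {a b : ℝ} (hab : a ≤ b) (ha : a ∈ Icc (0 : ℝ) 1)
    (hb : b ∈ Icc (0 : ℝ) 1) :
    (∫ x in a..b, f x * g x) ^ 2 ≤ (∫ x in a..b, f x ^ 2) * ∫ x in a..b, g x ^ 2 := by
  have i1 := (hf.mul hf).intervalIntegrable_sub ha hb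
  have i2 := (hf.mul hg).intervalIntegrable_sub ha hb
  have i3 := (hg.mul hg).intervalIntegrable_sub ha hb
  have key : ∀ t : ℝ, 0 ≤ (∫ x in a..b, g x * g x) * (t * t) +
      2 * (∫ x in a..b, f x * g x) * t + ∫ x in a..b, f x * f x := by
    intro t
    have e : ∫ x in a..b, (f x + t * g x) ^ 2 = (∫ x in a..b, g x * g x) * (t * t) +
      2 * (∫ x in a..b, f x * g x) * t + ∫ x in a..b, f x * f x := by
      have e1 : (fun x => (f x + t * g x) ^ 2) = fun x =>
          (t * t) * (g x * g x) + (2 * t) * (f x * g x) + f x * f x := by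
        ext x; ring
      rw [e1, intervalIntegral.integral_add ((i3.const_mul _).add (i2.const_mul _)) i1,
        intervalIntegral.integral_add (i3.const_mul _) (i2.const_mul _),
        intervalIntegral.integral_const_mul, intervalIntegral.integral_const_mul]
      ring
    rw [← e]
    exact intervalIntegral.integral_nonneg hab fun x _ => sq_nonneg _
  have h := discrim_le_zero key
  simp only [discrim] at h
  simp only [sq (f _), sq (g _)]
  nlinarith

theorem integral_sq_nonneg (f : ℝ → ℝ) : 0 ≤ ∫ x in (0 : ℝ)..1, f x ^ 2 :=
  intervalIntegral.integral_nonneg zero_le_one fun _ _ => sq_nonneg _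

/-- If `∫ w² = -∫ v w'` and `‖w'‖ ≤ √C ‖w‖`, then `‖w‖ ≤ √C ‖v‖`. -/
theorem le_of_sq_le_mul {A B D C : ℝ} (hA : 0 ≤ A) (hB : 0 ≤ B) (hC : 0 ≤ C) (h : A ^ 2 ≤ B * D)
    (hD : D ≤ C * A) : A ≤ C * B := by
  rcases hA.eq_or_lt with rfl | hA
  · positivity
  · have : A * A ≤ C * B * A := by nlinarith [mul_le_mul_of_nonneg_left hD hB]
    exact le_of_mul_le_mul_right this hA

/-! ### Piecewise polynomials -/

/-- `f` is a polynomial of degree at most `p` on each open cell of the uniform grid. -/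
def IsPiecewisePolynomial (p n : ℕ) (f : ℝ → ℝ) : Prop :=
  ∀ i < n, ∃ q : Polynomial ℝ, q.natDegree ≤ p ∧
    ∀ x ∈ Ioo ((i : ℝ) / n) (((i : ℝ) + 1) / n), f x = q.eval x

section Piecewise

variable {p n : ℕ} {f : ℝ → ℝ}

theorem cell_subset {i : ℕ} (hi : i < n) :
    Icc ((i : ℝ) / n) (((i : ℝ) + 1) / n) ⊆ Icc (0 : ℝ) 1 := by
  have hn : (0 : ℝ) < n := by exact_mod_cast (Nat.zero_le i).trans_lt hi
  refine Icc_subset_Icc (by positivity) ?_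
  rw [div_le_one hn]
  exact_mod_cast hi

theorem open_cell_subset {i : ℕ} (hi : i < n) :
    Ioo ((i : ℝ) / n) (((i : ℝ) + 1) / n) ⊆ Ioo (0 : ℝ) 1 := by
  have h := cell_subset hi
  have hn : (0 : ℝ) < n := by exact_mod_cast (Nat.zero_le i).trans_lt hi
  have hle : (i : ℝ) / n ≤ ((i : ℝ) + 1) / n := by gcongr; linarith
  exact Ioo_subset_Ioo (h (left_mem_Icc.2 hle)).1 (h (right_mem_Icc.2 hle)).2

/-- Every point of `(0,1)` off a countable set lies in an open cell. -/
theorem exists_countable_cells (n : ℕ) [NeZero n] : ∃ s : Set ℝ, s.Countable ∧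
    ∀ x ∈ Ioo (0 : ℝ) 1 \ s, ∃ i < n, x ∈ Ioo ((i : ℝ) / n) (((i : ℝ) + 1) / n) := by
  refine ⟨(fun i : ℕ => (i : ℝ) / n) '' univ, (countable_univ.image _), fun x hx => ?_⟩
  exact exists_cell (Ioo_subset_Icc_self hx.1) fun i _ h => hx.2 ⟨i, mem_univ _, h.symm⟩

theorem IsPiecewisePolynomial.boundedPiecewise [NeZero n] (hf : IsPiecewisePolynomial p n f) :
    BoundedPiecewise f := by
  obtain ⟨s, hs, hc⟩ := exists_countable_cells n
  choose! q hq hqf using hf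
  have hb : ∀ i, ∃ C, ∀ x ∈ Icc (0 : ℝ) 1, ‖(q i).eval x‖ ≤ C := fun i =>
    isCompact_Icc.exists_bound_of_continuousOn (q i).continuous.continuousOn
  choose C hC using hb
  refine ⟨s, hs, ∑ i ∈ Finset.range n, C i, fun x hx => ?_⟩
  obtain ⟨i, hi, hxi⟩ := hc x hx
  constructor
  · refine (q i).continuous.continuousAt.congr ?_
    filter_upwards [isOpen_Ioo.mem_nhds hxi] with y hy using (hqf i hi y hy).symm
  · rw [hqf i hi x hxi]
    refine (hC i x (Ioo_subset_Icc_self hx.1)).trans ?_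
    exact Finset.single_le_sum (f := C)
      (fun j _ => (norm_nonneg _).trans (hC j 0 (by simp))) (Finset.mem_range.2 hi)

theorem IsPiecewisePolynomial.deriv (hf : IsPiecewisePolynomial (p + 1) n f) :
    IsPiecewisePolynomial p n (deriv f) := by
  intro i hi
  obtain ⟨q, hq, hqf⟩ := hf i hi
  refine ⟨q.derivative, (q.natDegree_derivative_le).trans (by omega), fun x hx => ?_⟩
  refine HasDerivAt.deriv ((q.hasDerivAt x).congr_of_eventuallyEq ?_)
  filter_upwards [isOpen_Ioo.mem_nhds hx] with y hy using hqf y hy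

theorem IsPiecewisePolynomial.differentiableAt (hf : IsPiecewisePolynomial p n f) {i : ℕ}
    (hi : i < n) {x : ℝ} (hx : x ∈ Ioo ((i : ℝ) / n) (((i : ℝ) + 1) / n)) :
    DifferentiableAt ℝ f x := by
  obtain ⟨q, hq, hqf⟩ := hf i hi
  refine ((q.hasDerivAt x).congr_of_eventuallyEq ?_).differentiableAt
  filter_upwards [isOpen_Ioo.mem_nhds hx] with y hy using hqf y hy

theorem IsPiecewisePolynomial.mono {p' : ℕ} (hf : IsPiecewisePolynomial p n f) (h : p ≤ p') :
    IsPiecewisePolynomial p' n f := fun i hi =>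
  let ⟨q, hq, hqf⟩ := hf i hi
  ⟨q, hq.trans h, hqf⟩

/-- A continuous piecewise polynomial is a primitive of its derivative. -/
theorem IsPiecewisePolynomial.isPiecewisePrimitive [NeZero n] (hf : IsPiecewisePolynomial p n f)
    (hc : ContinuousOn f (Icc 0 1)) : IsPiecewisePrimitive f (_root_.deriv f) where
  continuousOn := hc
  boundedPiecewise := (hf.mono p.le_succ).deriv.boundedPiecewise
  hasDerivAt := by
    obtain ⟨s, hs, h⟩ := exists_countable_cells n
    refine ⟨s, hs, fun x hx => ?_⟩
    obtain ⟨i, hi, hxi⟩ := h x hx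
    exact (hf.differentiableAt hi hxi).hasDerivAt

/-- Splitting of an integral over `[0,1]` into the cells. -/
theorem sum_integral_cells [NeZero n] (hf : BoundedPiecewise f) :
    ∑ i ∈ Finset.range n, ∫ x in ((i : ℝ) / n)..(((i : ℝ) + 1) / n), f x =
      ∫ x in (0 : ℝ)..1, f x := by
  have hn : (n : ℝ) ≠ 0 := NeZero.ne _
  have h := intervalIntegral.sum_integral_adjacent_intervals (μ := volume) (f := f)
    (a := fun i : ℕ => (i : ℝ) / n) (n := n) (fun i hi => by
      have h := cell_subset hi
      have hle : (i : ℝ) / n ≤ ((i : ℝ) + 1) / n := by gcongr; linarith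
      push_cast
      exact hf.intervalIntegrable_sub (h (left_mem_Icc.2 hle)) (h (right_mem_Icc.2 hle)))
  push_cast at h
  simpa [hn] using h

/-- An inequality on every cell can be summed up. -/
theorem integral_le_of_cells [NeZero n] {f g : ℝ → ℝ} (hf : BoundedPiecewise f)
    (hg : BoundedPiecewise g) {C : ℝ}
    (h : ∀ i < n, ∫ x in ((i : ℝ) / n)..(((i : ℝ) + 1) / n), f x ≤
      C * ∫ x in ((i : ℝ) / n)..(((i : ℝ) + 1) / n), g x) :
    ∫ x in (0 : ℝ)..1, f x ≤ C * ∫ x in (0 : ℝ)..1, g x := by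
  rw [← sum_integral_cells (n := n) hf, ← sum_integral_cells (n := n) hg, Finset.mul_sum]
  exact Finset.sum_le_sum fun i hi => h i (Finset.mem_range.1 hi)

theorem BoundedPiecewise.sq {f : ℝ → ℝ} (hf : BoundedPiecewise f) :
    BoundedPiecewise fun x => f x ^ 2 := by
  simpa only [_root_.sq] using hf.mul hf

/-! ### The inverse inequality -/

/-- The argument is cellwise, so neither continuity nor boundary conditions are needed. It therefore
serves both as the base of the induction on the degree and for arbitrary splines with `p = 1`. -/
theorem integral_deriv_sq_le_of_linear [NeZero n] (hf : IsPiecewisePolynomial 1 n f) :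
    ∫ x in (0 : ℝ)..1, deriv f x ^ 2 ≤ 12 * (n : ℝ) ^ 2 * ∫ x in (0 : ℝ)..1, f x ^ 2 := by
  have hn : (0 : ℝ) < n := by exact_mod_cast NeZero.pos n
  refine integral_le_of_cells (n := n) hf.deriv.boundedPiecewise.sq
    hf.boundedPiecewise.sq fun i hi => ?_
  obtain ⟨q, hq, hqf⟩ := hf i hi
  obtain ⟨c, d, rfl⟩ := Polynomial.exists_eq_X_add_C_of_natDegree_le_one hq
  set a : ℝ := (i : ℝ) / n with ha
  have hb : ((i : ℝ) + 1) / n = a + 1 / n := by rw [ha]; ring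
  rw [hb] at hqf ⊢
  have hab : a ≤ a + 1 / n := by have : 0 < 1 / (n : ℝ) := by positivity
                                 linarith
  have e1 : ∫ x in a..(a + 1 / n), f x ^ 2 = ∫ x in a..(a + 1 / n), (c * x + d) ^ 2 := by
    refine intervalIntegral.integral_congr_uIoo fun x hx => ?_
    rw [uIoo_of_le hab] at hx
    simp [hqf x hx]
  have e2 : ∫ x in a..(a + 1 / n), deriv f x ^ 2 = ∫ x in a..(a + 1 / n), c ^ 2 := by
    refine intervalIntegral.integral_congr_uIoo fun x hx => ?_
    rw [uIoo_of_le hab] at hx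
    have : HasDerivAt f c x := by
      have h1 : HasDerivAt (fun y => c * y + d) c x := by
        simpa using ((hasDerivAt_id x).const_mul c).add_const d
      refine h1.congr_of_eventuallyEq ?_
      filter_upwards [isOpen_Ioo.mem_nhds hx] with y hy
      simp [hqf y hy]
    simp only [this.deriv]
  have e3 : ∫ x in a..(a + 1 / n), (c * x + d) ^ 2 =
      (c ^ 2 * (a + 1 / n) ^ 3 / 3 + c * d * (a + 1 / n) ^ 2 + d ^ 2 * (a + 1 / n)) -
        (c ^ 2 * a ^ 3 / 3 + c * d * a ^ 2 + d ^ 2 * a) := by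
    refine intervalIntegral.integral_eq_sub_of_hasDerivAt
      (f := fun x => c ^ 2 * x ^ 3 / 3 + c * d * x ^ 2 + d ^ 2 * x) (fun x _ => ?_)
      ((by fun_prop : Continuous fun x : ℝ => (c * x + d) ^ 2).intervalIntegrable _ _)
    have := ((((hasDerivAt_pow 3 x).const_mul (c ^ 2)).div_const 3).add
      ((hasDerivAt_pow 2 x).const_mul (c * d))).add ((hasDerivAt_id x).const_mul (d ^ 2))
    exact this.congr_deriv (by push_cast; ring)
  rw [e1, e2, e3, intervalIntegral.integral_const]
  -- On a cell of length `h`, the slope and the midpoint value are orthogonal contributions: `∫ (c x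
  -- + d)² = c² h³ / 12 + h (midpoint value)²`. Hence the constant `12`.
  have e4 : 12 * (n : ℝ) ^ 2 * ((c ^ 2 * (a + 1 / n) ^ 3 / 3 + c * d * (a + 1 / n) ^ 2 +
      d ^ 2 * (a + 1 / n)) - (c ^ 2 * a ^ 3 / 3 + c * d * a ^ 2 + d ^ 2 * a)) =
      c ^ 2 * (1 / n) + 12 * n * (c * (a + 1 / (2 * n)) + d) ^ 2 := by
    field_simp
    ring
  rw [e4, smul_eq_mul, add_sub_cancel_left, mul_comm]
  have : 0 ≤ 12 * n * (c * (a + 1 / (2 * n)) + d) ^ 2 := by positivity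
  linarith

/-- The derivative within `[0,1]` of a `C¹` function is the derivative in the interior. -/
theorem derivWithin_Icc_eq {x : ℝ} (hx : x ∈ Ioo (0 : ℝ) 1) :
    derivWithin f (Icc 0 1) x = deriv f x :=
  derivWithin_of_mem_nhds (Icc_mem_nhds hx.1 hx.2)

theorem integral_congr_Ioo {f g : ℝ → ℝ} (h : ∀ x ∈ Ioo (0 : ℝ) 1, f x = g x) :
    ∫ x in (0 : ℝ)..1, f x = ∫ x in (0 : ℝ)..1, g x :=
  intervalIntegral.integral_congr_uIoo fun x hx => h x (by rwa [uIoo_of_le zero_le_one] at hx)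

theorem isPiecewisePrimitive_derivWithin (hf : ContDiffOn ℝ 1 f (Icc 0 1)) :
    IsPiecewisePrimitive f (derivWithin f (Icc 0 1)) where
  continuousOn := hf.continuousOn
  boundedPiecewise := .of_continuousOn (hf.continuousOn_derivWithin uniqueDiffOn_Icc_zero_one le_rfl)
  hasDerivAt := by
    refine ⟨∅, countable_empty, fun x hx => ?_⟩
    rw [derivWithin_Icc_eq hx.1]
    exact ((hf.differentiableOn one_ne_zero).differentiableAt
      (Icc_mem_nhds hx.1.1 hx.1.2)).hasDerivAt

theorem IsPiecewisePolynomial.derivWithin (hf : IsPiecewisePolynomial (p + 1) n f) :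
    IsPiecewisePolynomial p n (derivWithin f (Icc 0 1)) := by
  intro i hi
  obtain ⟨q, hq, hqf⟩ := hf.deriv i hi
  exact ⟨q, hq, fun x hx => by rw [derivWithin_Icc_eq (open_cell_subset hi hx), hqf x hx]⟩

/-- The inverse inequality for splines whose derivatives of even order, or of odd order, below the
degree vanish at the boundary. -/
theorem integral_deriv_sq_le [NeZero n] (p ε : ℕ) (f : ℝ → ℝ) (hf : IsPiecewisePolynomial (p + 1) n f)
    (hs : ContDiffOn ℝ (p : WithTop ℕ∞) f (Icc 0 1))
    (hbd : ∀ k < p + 1, Even (k + ε) → iteratedDerivWithin k f (Icc (0 : ℝ) 1) 0 = 0 ∧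
      iteratedDerivWithin k f (Icc (0 : ℝ) 1) 1 = 0) :
    ∫ x in (0 : ℝ)..1, deriv f x ^ 2 ≤ 12 * (n : ℝ) ^ 2 * ∫ x in (0 : ℝ)..1, f x ^ 2 := by
  induction p generalizing ε f with
  | zero => exact integral_deriv_sq_le_of_linear hf
  | succ p ih =>
    set w := derivWithin f (Icc (0 : ℝ) 1) with hw
    have hsw : ContDiffOn ℝ (p : WithTop ℕ∞) w (Icc 0 1) := by
      refine hs.derivWithin uniqueDiffOn_Icc_zero_one ?_
      exact_mod_cast le_rfl
    -- Differentiation shifts the orders by one, so the parity of the boundary conditions switches.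
    have h1 := ih (ε + 1) w hf.derivWithin hsw (fun k hk he => by
      have := hbd (k + 1) (by omega) (by rwa [add_right_comm])
      rwa [iteratedDerivWithin_succ', ← hw] at this)
    have hfw := isPiecewisePrimitive_derivWithin (hs.of_le (by exact_mod_cast (by omega : 1 ≤ p + 1)))
    rw [← hw] at hfw
    have hww := hf.derivWithin.isPiecewisePrimitive hsw.continuousOn
    rw [← hw] at hww
    have h2 := hww.integral_mul hfw
    -- One factor always vanishes at the boundary: `f` itself for even `ε`, its derivative `w` for
    -- odd `ε`.
    have h3 : w 1 * f 1 - w 0 * f 0 = 0 := by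
      rcases Nat.even_or_odd ε with he | he
      · have := hbd 0 (by omega) (by simpa using he)
        simp only [iteratedDerivWithin_zero] at this
        rw [this.1, this.2]; ring
      · have := hbd 1 (by omega) (by rw [add_comm]; exact he.add_one)
        simp only [iteratedDerivWithin_one, ← hw] at this
        rw [this.1, this.2]; ring
    have h4 := hfw.bounded.sq_integral_mul_le hww.boundedPiecewise zero_le_one
      (left_mem_Icc.2 zero_le_one) (right_mem_Icc.2 zero_le_one)
    have h5 : ∫ x in (0 : ℝ)..1, deriv f x ^ 2 = ∫ x in (0 : ℝ)..1, w x ^ 2 :=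
      integral_congr_Ioo fun x hx => by rw [hw, derivWithin_Icc_eq hx]
    have h6 : (∫ x in (0 : ℝ)..1, w x ^ 2) = - ∫ x in (0 : ℝ)..1, f x * deriv w x := by
      simp only [sq (w _)]
      rw [h2, h3, zero_sub]
      simp only [mul_comm]
    rw [h5]
    refine le_of_sq_le_mul (integral_sq_nonneg w) (integral_sq_nonneg f) (by positivity) ?_ h1
    rw [h6, neg_sq]
    exact h4

end Piecewise

/-! ### The approximation property of splines of maximum smoothness -/

/-- Splines of degree `p` and smoothness `C^(p-1)`; no smoothness is required for `p = 0`. -/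
structure IsSpline (p n : ℕ) (s : ℝ → ℝ) : Prop where
  poly : IsPiecewisePolynomial p n s
  smooth : 1 ≤ p → ContDiffOn ℝ ((p - 1 : ℕ) : WithTop ℕ∞) s (Icc 0 1)

theorem Polynomial.exists_derivative_eq (q : Polynomial ℝ) :
    ∃ Q : Polynomial ℝ, Q.natDegree ≤ q.natDegree + 1 ∧ Q.derivative = q := by
  refine ⟨∑ i ∈ Finset.range (q.natDegree + 1), Polynomial.monomial (i + 1) (q.coeff i / (i + 1)),
    Polynomial.natDegree_sum_le_of_forall_le _ _ fun i hi => ?_, ?_⟩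
  · exact (Polynomial.natDegree_monomial_le _).trans (by have := Finset.mem_range.1 hi; omega)
  · conv_rhs => rw [q.as_sum_range]
    rw [Polynomial.derivative_sum]
    refine Finset.sum_congr rfl fun i _ => ?_
    have : (i : ℝ) + 1 ≠ 0 := by positivity
    rw [Polynomial.derivative_monomial]
    push_cast
    rw [div_mul_cancel₀ _ this]

variable {p n : ℕ}

theorem isSpline_const (p n : ℕ) (c : ℝ) : IsSpline p n fun _ => c :=
  ⟨fun _ _ => ⟨Polynomial.C c, by simp, fun _ _ => by simp⟩, fun _ => contDiffOn_const⟩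

theorem IsSpline.indicator_mem {s : ℝ → ℝ} (hs : IsSpline p n s) (hp : 1 ≤ p) :
    (Icc (0 : ℝ) 1).indicator s ∈ SplineSpace p n := by
  refine ⟨fun x hx => indicator_of_notMem hx s, (hs.smooth hp).congr fun x hx =>
    indicator_of_mem hx s, fun i hi => ?_⟩
  obtain ⟨q, hq, hqs⟩ := hs.poly i hi
  refine ⟨q, hq, fun x hx => ?_⟩
  rw [indicator_of_mem (Ioo_subset_Icc_self (open_cell_subset hi hx)), hqs x hx]

theorem IsPiecewisePolynomial.primitive [NeZero n] {s : ℝ → ℝ} (hs : IsPiecewisePolynomial p n s) :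
    IsPiecewisePolynomial (p + 1) n (primitive s) := by
  intro i hi
  obtain ⟨q, hq, hqs⟩ := hs i hi
  obtain ⟨Q, hQ, hQq⟩ := q.exists_derivative_eq
  set a : ℝ := (i : ℝ) / n
  refine ⟨Q + Polynomial.C (_root_.primitive s a - Q.eval a), ?_, fun x hx => ?_⟩
  · refine (Polynomial.natDegree_add_C).trans_le ?_
    omega
  · have hx01 := Ioo_subset_Icc_self (open_cell_subset hi hx)
    have ha01 : a ∈ Icc (0 : ℝ) 1 := cell_subset hi (left_mem_Icc.2 (hx.1.trans hx.2).le)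
    have h1 := intervalIntegral.integral_add_adjacent_intervals
      (hs.boundedPiecewise.intervalIntegrable_sub (left_mem_Icc.2 zero_le_one) ha01)
      (hs.boundedPiecewise.intervalIntegrable_sub ha01 hx01)
    have h2 : ∫ t in a..x, s t = ∫ t in a..x, q.eval t := by
      refine intervalIntegral.integral_congr_uIoo fun t ht => ?_
      rw [uIoo_of_le hx.1.le] at ht
      exact hqs t ⟨ht.1, ht.2.trans hx.2⟩
    have h3 : ∫ t in a..x, q.eval t = Q.eval x - Q.eval a :=
      intervalIntegral.integral_eq_sub_of_hasDerivAt (f := fun t => Q.eval t)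
        (fun t _ => by simpa [hQq] using Q.hasDerivAt t) (q.continuous.intervalIntegrable _ _)
    rw [h2, h3] at h1
    simp only [_root_.primitive, Polynomial.eval_add, Polynomial.eval_C] at h1 ⊢
    linarith

theorem hasDerivWithinAt_primitive {s : ℝ → ℝ} (hs : ContinuousOn s (Icc 0 1)) {x : ℝ}
    (hx : x ∈ Icc (0 : ℝ) 1) : HasDerivWithinAt (primitive s) (s x) (Icc 0 1) x := by
  have := Fact.mk hx
  have hb := BoundedPiecewise.of_continuousOn hs
  exact intervalIntegral.integral_hasDerivWithinAt_right
    (hb.intervalIntegrable_sub (by simp) hx)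
    ⟨Icc 0 1, self_mem_nhdsWithin, hs.aestronglyMeasurable measurableSet_Icc⟩ (hs x hx)

/-- Integration raises degree and smoothness together, so maximum smoothness is preserved. For `p =
0` the integrand may jump, and only continuity of the primitive is asserted. -/
theorem IsSpline.primitive [NeZero n] {s : ℝ → ℝ} (hs : IsSpline p n s) :
    IsSpline (p + 1) n (primitive s) := by
  refine ⟨hs.poly.primitive, fun _ => ?_⟩
  rw [Nat.add_sub_cancel]
  cases p with
  | zero =>
    simpa using hs.poly.boundedPiecewise.isPiecewisePrimitive.continuousOn
  | succ p =>
    have hsm := hs.smooth (by omega)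
    rw [Nat.add_sub_cancel] at hsm
    have hd := fun x hx => hasDerivWithinAt_primitive hsm.continuousOn (x := x) hx
    push_cast
    rw [contDiffOn_succ_iff_derivWithin uniqueDiffOn_Icc_zero_one]
    refine ⟨fun x hx => (hd x hx).differentiableWithinAt, fun h => ?_, hsm.congr fun x hx =>
      (hd x hx).derivWithin (uniqueDiffOn_Icc_zero_one x hx)⟩
    exact absurd h (by exact_mod_cast WithTop.coe_ne_top)

theorem primitive_one_eq_zero {r : ℝ → ℝ}
    (h : ∀ s, IsSpline p n s → ∫ x in (0 : ℝ)..1, r x * s x = 0) : primitive r 1 = 0 := by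
  simpa [primitive] using h _ (isSpline_const p n 1)

/-- A function orthogonal to the piecewise constants has a small primitive. -/
theorem integral_primitive_sq_le_of_const [NeZero n] {r : ℝ → ℝ} (hr : BoundedPiecewise r)
    (h : ∀ s, IsSpline 0 n s → ∫ x in (0 : ℝ)..1, r x * s x = 0) :
    ∫ x in (0 : ℝ)..1, primitive r x ^ 2 ≤ (1 / (n : ℝ)) ^ 2 * ∫ x in (0 : ℝ)..1, r x ^ 2 := by
  have hn : (0 : ℝ) < n := by exact_mod_cast NeZero.pos n
  refine integral_le_of_cells (n := n) hr.isPiecewisePrimitive.bounded.sq hr.sq fun i hi => ?_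
  have hle : (i : ℝ) / n ≤ ((i : ℝ) + 1) / n := by gcongr; linarith
  have ha01 := cell_subset hi (left_mem_Icc.2 hle)
  have hb01 := cell_subset hi (right_mem_Icc.2 hle)
  have hba : ((i : ℝ) + 1) / n - (i : ℝ) / n = 1 / n := by ring
  -- The primitive vanishes at each grid point: test with the indicator of `(-∞, i / n]`, which is
  -- piecewise constant.
  have h0 : primitive r ((i : ℝ) / n) = 0 := by
    have hs : IsSpline 0 n ((Iic ((i : ℝ) / n)).indicator fun _ => (1 : ℝ)) := by
      refine ⟨fun j hj => ?_, fun h => absurd h (by norm_num)⟩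
      rcases lt_or_ge j i with hji | hij
      · refine ⟨1, by simp, fun x hx => ?_⟩
        rw [indicator_of_mem, Polynomial.eval_one]
        refine hx.2.le.trans ?_
        gcongr
        exact_mod_cast hji
      · refine ⟨0, by simp, fun x hx => ?_⟩
        rw [indicator_of_notMem, Polynomial.eval_zero]
        have : (i : ℝ) / n ≤ (j : ℝ) / n := by gcongr
        exact not_le.2 (this.trans_lt hx.1)
    have h1 := h _ hs
    have i1 := hr.intervalIntegrable_sub (show (0 : ℝ) ∈ Icc (0 : ℝ) 1 by simp) ha01
    have e1 : ∫ x in (0 : ℝ)..((i : ℝ) / n),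
        r x * (Iic ((i : ℝ) / n)).indicator (fun _ => (1 : ℝ)) x = primitive r ((i : ℝ) / n) := by
      refine intervalIntegral.integral_congr_uIoo fun x hx => ?_
      rw [uIoo_of_le ha01.1] at hx
      simp [indicator_of_mem (show x ∈ Iic ((i : ℝ) / n) from hx.2.le)]
    have e2 : ∫ x in ((i : ℝ) / n)..1,
        r x * (Iic ((i : ℝ) / n)).indicator (fun _ => (1 : ℝ)) x = 0 := by
      rw [← intervalIntegral.integral_zero (μ := volume) (a := (i : ℝ) / n) (b := 1) (E := ℝ)]
      refine intervalIntegral.integral_congr_uIoo fun x hx => ?_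
      rw [uIoo_of_le ha01.2] at hx
      simp [indicator_of_notMem (show x ∉ Iic ((i : ℝ) / n) from not_le.2 hx.1)]
    have hb := hr.mul hs.poly.boundedPiecewise
    have h2 := intervalIntegral.integral_add_adjacent_intervals
      (hb.intervalIntegrable_sub (left_mem_Icc.2 zero_le_one) ha01)
      (hb.intervalIntegrable_sub ha01 (right_mem_Icc.2 zero_le_one))
    rw [e1, e2, h1] at h2
    linarith
  set R := ∫ x in ((i : ℝ) / n)..(((i : ℝ) + 1) / n), r x ^ 2 with hR
  -- Cauchy-Schwarz for `∫ r` from the left end of the cell, where the primitive is zero.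
  have hpt : ∀ x ∈ Icc ((i : ℝ) / n) (((i : ℝ) + 1) / n), primitive r x ^ 2 ≤ 1 / n * R := by
    intro x hx
    have hx01 := cell_subset hi hx
    have h1 := intervalIntegral.integral_add_adjacent_intervals
      (hr.intervalIntegrable_sub (show (0 : ℝ) ∈ Icc (0 : ℝ) 1 by simp) ha01)
      (hr.intervalIntegrable_sub ha01 hx01)
    have h2 : primitive r x = ∫ t in ((i : ℝ) / n)..x, 1 * r t := by
      simp only [primitive, one_mul] at h0 h1 ⊢
      rw [← h1, h0, zero_add]
    have h3 := (BoundedPiecewise.const 1).sq_integral_mul_le hr hx.1 ha01 hx01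
    rw [← h2] at h3
    refine h3.trans ?_
    have h4 := intervalIntegral.integral_add_adjacent_intervals
      (hr.sq.intervalIntegrable_sub ha01 hx01) (hr.sq.intervalIntegrable_sub hx01 hb01)
    have h5 : 0 ≤ ∫ t in x..(((i : ℝ) + 1) / n), r t ^ 2 :=
      intervalIntegral.integral_nonneg hx.2 fun _ _ => sq_nonneg _
    have h6 : 0 ≤ ∫ t in ((i : ℝ) / n)..x, r t ^ 2 :=
      intervalIntegral.integral_nonneg hx.1 fun _ _ => sq_nonneg _
    refine mul_le_mul ?_ (by linarith) h6 (by positivity)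
    simp only [one_pow, intervalIntegral.integral_const, smul_eq_mul, mul_one]
    linarith [hx.2]
  have := intervalIntegral.integral_mono_on hle
    (hr.isPiecewisePrimitive.bounded.sq.intervalIntegrable_sub ha01 hb01)
    (intervalIntegrable_const (c := 1 / n * R)) hpt
  refine this.trans_eq ?_
  rw [intervalIntegral.integral_const, hba, smul_eq_mul]
  ring

/-- A function orthogonal to the splines of degree `p` has a primitive that is small, uniformly in
the degree. -/
theorem integral_primitive_sq_le [NeZero n] (p : ℕ) {r : ℝ → ℝ} (hr : BoundedPiecewise r)
    (h : ∀ s, IsSpline p n s → ∫ x in (0 : ℝ)..1, r x * s x = 0) :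
    ∫ x in (0 : ℝ)..1, primitive r x ^ 2 ≤ (1 / (n : ℝ)) ^ 2 * ∫ x in (0 : ℝ)..1, r x ^ 2 := by
  induction p generalizing r with
  | zero => exact integral_primitive_sq_le_of_const hr h
  | succ p ih =>
    have h1 := primitive_one_eq_zero h
    have hP := hr.isPiecewisePrimitive
    have hPP := hP.bounded.isPiecewisePrimitive
    -- The primitive of `r` is orthogonal to the splines of one degree less: `∫ (primitive r) s = -∫
    -- r (primitive s)`, the boundary terms being zero because `r` is orthogonal to constants.
    have h2 := ih hP.bounded fun s hs => by
      have := hP.integral_mul hs.poly.boundedPiecewise.isPiecewisePrimitive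
      rw [this, h1, h _ hs.primitive]
      simp
    have h3 := hP.integral_mul hPP
    have h4 := hr.sq_integral_mul_le hPP.bounded zero_le_one
      (left_mem_Icc.2 zero_le_one) (right_mem_Icc.2 zero_le_one)
    have h5 : ∫ x in (0 : ℝ)..1, primitive r x ^ 2 =
        - ∫ x in (0 : ℝ)..1, r x * primitive (primitive r) x := by
      simp only [sq]
      rw [h3, h1]
      simp
    refine le_of_sq_le_mul (integral_sq_nonneg _) (integral_sq_nonneg _) (by positivity) ?_ h2
    rw [h5, neg_sq]
    exact h4

theorem integral_congr_off_countable {f g : ℝ → ℝ} {s : Set ℝ} (hs : s.Countable)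
    (h : ∀ x ∈ Ioo (0 : ℝ) 1 \ s, f x = g x) :
    ∫ x in (0 : ℝ)..1, f x = ∫ x in (0 : ℝ)..1, g x := by
  simp only [intervalIntegral.integral_of_le zero_le_one, integral_Ioc_eq_integral_Ioo]
  refine integral_congr_ae ?_
  filter_upwards [ae_restrict_mem measurableSet_Ioo, ae_restrict_of_ae (hs.ae_notMem volume)]
    with x hx hxs using h x ⟨hx, hxs⟩

theorem deriv_indicator_Icc {f : ℝ → ℝ} {x : ℝ} (hx : x ∈ Ioo (0 : ℝ) 1) :
    deriv ((Icc (0 : ℝ) 1).indicator f) x = deriv f x := by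
  refine Filter.EventuallyEq.deriv_eq ?_
  filter_upwards [Icc_mem_nhds hx.1 hx.2] with y hy using indicator_of_mem hy f

/-- The Aubin-Nitsche estimate for functions that are energy-orthogonal to a spline space. -/
theorem integral_sq_le_of_orthogonal [NeZero n] {e e' : ℝ → ℝ} (he : IsPiecewisePrimitive e e')
    (h : ∀ χ ∈ SplineSpace (p + 1) n,
      (∫ x in (0 : ℝ)..1, e' x * deriv χ x) + ∫ x in (0 : ℝ)..1, e x * χ x = 0) :
    ∫ x in (0 : ℝ)..1, e x ^ 2 ≤ 8 / 3 * (1 / (n : ℝ)) ^ 2 *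
      ((∫ x in (0 : ℝ)..1, e' x ^ 2) + ∫ x in (0 : ℝ)..1, e x ^ 2) := by
  have hG := he.bounded.isPiecewisePrimitive
  -- The constant test function `1` shows that `e` has mean zero.
  have hG1 : primitive e 1 = 0 := by
    have h1 := h _ ((isSpline_const (p + 1) n 1).indicator_mem (by omega))
    rw [integral_congr_Ioo (f := fun x => e' x * _) (g := fun _ => 0) fun x hx => by
        rw [deriv_indicator_Icc hx, deriv_const, mul_zero],
      integral_congr_Ioo (f := fun x => e x * _) (g := e) fun x hx => by
        rw [indicator_of_mem (Ioo_subset_Icc_self hx), mul_one]] at h1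
    simpa [primitive] using h1
  have hr : BoundedPiecewise fun x => e' x + -primitive e x :=
    he.boundedPiecewise.add hG.bounded.neg
  -- Testing with `χ = primitive s` and integrating the mass term by parts exposes an integrated
  -- residual that is `L²`-orthogonal to the splines of degree `p`.
  have horth : ∀ s, IsSpline p n s → ∫ x in (0 : ℝ)..1, (e' x + -primitive e x) * s x = 0 := by
    intro s hs
    have hsb := hs.poly.boundedPiecewise
    have hsP := hsb.isPiecewisePrimitive
    have h1 := h _ (hs.primitive.indicator_mem (by omega))
    obtain ⟨t, ht, hst⟩ := hsP.hasDerivAt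
    rw [integral_congr_off_countable (g := fun x => e' x * s x) ht fun x hx => by
        rw [deriv_indicator_Icc hx.1, (hst x hx).deriv],
      integral_congr_Ioo (f := fun x => e x * _) (g := fun x => e x * primitive s x) fun x hx => by
        rw [indicator_of_mem (Ioo_subset_Icc_self hx)]] at h1
    have h2 := hG.integral_mul hsP
    rw [hG1] at h2
    simp only [add_mul, neg_mul]
    rw [intervalIntegral.integral_add (he.boundedPiecewise.mul hsb).intervalIntegrable
      (hG.bounded.mul hsb).neg.intervalIntegrable, intervalIntegral.integral_neg, h2]
    simp only [primitive_zero, zero_mul, sub_zero, zero_sub, neg_neg]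
    exact h1
  have h1 := integral_primitive_sq_le p hr horth
  set r : ℝ → ℝ := fun x => e' x + -primitive e x with hrd
  have hP := hr.isPiecewisePrimitive
  have h2 := hP.bounded.sq_integral_mul_le he.bounded zero_le_one
    (left_mem_Icc.2 zero_le_one) (right_mem_Icc.2 zero_le_one)
  -- With `G = primitive e`, two integrations by parts give `∫ (primitive r) e = -∫ r G = ‖e‖² +
  -- ‖G‖²`, so Cauchy-Schwarz bounds the right-hand side by `‖primitive r‖ ‖e‖`. No auxiliary dual
  -- problem is needed.
  have h3 := hP.integral_mul hG
  have h4 := hG.integral_mul he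
  rw [hG1] at h3 h4
  simp only [primitive_zero, zero_mul, mul_zero, sub_zero, zero_sub] at h3 h4
  simp only [← sq] at h4
  have i1 := (he.boundedPiecewise.sq).intervalIntegrable
  have i2 := (hG.bounded.mul he.boundedPiecewise).intervalIntegrable
  have i3 := hG.bounded.sq.intervalIntegrable
  have h5 : ∫ x in (0 : ℝ)..1, r x * primitive e x =
      (∫ x in (0 : ℝ)..1, primitive e x * e' x) - ∫ x in (0 : ℝ)..1, primitive e x ^ 2 := by
    rw [← intervalIntegral.integral_sub i2 i3]
    refine intervalIntegral.integral_congr fun x _ => ?_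
    simp only [hrd]; ring
  have h6 : ∫ x in (0 : ℝ)..1, r x ^ 2 = (∫ x in (0 : ℝ)..1, e' x ^ 2) -
      2 * (∫ x in (0 : ℝ)..1, primitive e x * e' x) + ∫ x in (0 : ℝ)..1, primitive e x ^ 2 := by
    rw [← intervalIntegral.integral_const_mul, ← intervalIntegral.integral_sub i1 (i2.const_mul 2),
      ← intervalIntegral.integral_add (i1.sub (i2.const_mul 2)) i3]
    refine intervalIntegral.integral_congr fun x _ => ?_
    simp only [hrd]; ring
  have n1 := integral_sq_nonneg e
  have n2 := integral_sq_nonneg e'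
  have n3 := integral_sq_nonneg (primitive e)
  have n4 := integral_sq_nonneg r
  have hc1 : (1 / (n : ℝ)) ^ 2 ≤ 1 := by
    have : (1 : ℝ) ≤ n := by exact_mod_cast NeZero.one_le
    rw [div_pow, one_pow, div_le_one (by positivity)]
    nlinarith
  rw [h3, h5, h4] at h2
  rw [h4] at h6
  generalize (∫ x in (0 : ℝ)..1, e x ^ 2) = X at *
  generalize (∫ x in (0 : ℝ)..1, e' x ^ 2) = D at *
  generalize (∫ x in (0 : ℝ)..1, primitive e x ^ 2) = g at *
  generalize (∫ x in (0 : ℝ)..1, r x ^ 2) = R at *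
  generalize (∫ x in (0 : ℝ)..1, primitive r x ^ 2) = Q at *
  have c0 : 0 ≤ (1 / (n : ℝ)) ^ 2 := sq_nonneg _
  generalize (1 / (n : ℝ)) ^ 2 = c at *
  rcases n1.eq_or_lt with rfl | n1
  · positivity
  · have k1 : (X + g) ^ 2 ≤ c * R * X := by
      calc (X + g) ^ 2 = (-(-X - g)) ^ 2 := by ring
        _ ≤ _ := h2
        _ ≤ _ := mul_le_mul_of_nonneg_right h1 n1.le
    have k2 : X ≤ c * R := by
      refine le_of_mul_le_mul_right (le_trans ?_ k1) n1
      nlinarith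
    have k3 : 4 * g ≤ c * R := by
      refine le_of_mul_le_mul_right (le_trans ?_ k1) n1
      nlinarith [sq_nonneg (X - g)]
    have k4 : c * R ≤ R := mul_le_of_le_one_left n4 hc1
    -- Here `R = D + 2 X + g` and `g ≤ R / 4`, so `R ≤ (4/3) (D + 2 X)`; this is the origin of
    -- `8/3`.
    have k5 : R ≤ 8 / 3 * (D + X) := by linarith
    calc X ≤ c * R := k2
      _ ≤ c * (8 / 3 * (D + X)) := mul_le_mul_of_nonneg_left k5 c0
      _ = _ := by ring

/-! ### The two estimates for the smoother -/

section Estimates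

variable {p n : ℕ} [NeZero n]

theorem massForm_apply (u v : SplineSpace p n) :
    massForm p n u v = ∫ x in (0 : ℝ)..1, (u : ℝ → ℝ) x * (v : ℝ → ℝ) x := rfl

theorem energyForm_symm (u v : SplineSpace p n) : energyForm p n u v = energyForm p n v u := by
  simp only [energyForm_apply, mul_comm]

theorem energyForm_self_nonneg (u : SplineSpace p n) : 0 ≤ energyForm p n u u := by
  simp only [energyForm_apply, ← sq]
  exact add_nonneg (integral_sq_nonneg _) (integral_sq_nonneg _)

theorem massForm_self_nonneg (u : SplineSpace p n) : 0 ≤ massForm p n u u := by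
  simp only [massForm_apply, ← sq]
  exact integral_sq_nonneg _

theorem SplineSpace.isPiecewisePrimitive (u : SplineSpace p n) :
    IsPiecewisePrimitive (u : ℝ → ℝ) (deriv (u : ℝ → ℝ)) :=
  IsPiecewisePolynomial.isPiecewisePrimitive u.2.2.2 (SplineSpace.continuousOn u)

variable (W : Submodule ℝ (SplineSpace p n))

theorem energyForm_projector_sub (u w : SplineSpace p n) (hw : w ∈ W) :
    energyForm p n w (u - energyProjector W u) = 0 :=
  Submodule.sub_projection_mem (energyForm_isCompl W) u w hw

theorem energyForm_projector_pythagoras (u : SplineSpace p n) :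
    energyForm p n u u = energyForm p n (energyProjector W u) (energyProjector W u) +
      energyForm p n (u - energyProjector W u) (u - energyProjector W u) := by
  have ht : energyProjector W u ∈ W := Submodule.projection_apply_mem (energyForm_isCompl W) u
  have h := energyForm_projector_sub W u _ ht
  have h' := energyForm_symm (energyProjector W u) u
  simp only [map_sub, LinearMap.sub_apply] at h ⊢
  linarith

/-- The form of the boundary-corrected mass-Richardson smoother. -/
def smootherForm (W : Submodule ℝ (SplineSpace p n)) : LinearMap.BilinForm ℝ (SplineSpace p n) :=
  ((1 / (n : ℝ)) ^ 2)⁻¹ • massForm p n +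
    (energyForm p n).compl₁₂ (1 - energyProjector W) (1 - energyProjector W)

theorem smootherForm_apply (u v : SplineSpace p n) : smootherForm W u v =
    (n : ℝ) ^ 2 * massForm p n u v +
      energyForm p n (u - energyProjector W u) (v - energyProjector W v) := by
  simp [smootherForm]

/-- The energy is bounded by the smoother. -/
theorem energyForm_le_smootherForm (hp : 1 ≤ p) (hW : W ≤ ReducedSplineSpace p n)
    (u : SplineSpace p n) : energyForm p n u u ≤ 13 * smootherForm W u u := by
  have hn1 : (1 : ℝ) ≤ n := by exact_mod_cast NeZero.one_le
  have hn2 : (1 : ℝ) ≤ (n : ℝ) ^ 2 := by nlinarith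
  have hm := massForm_self_nonneg u
  have hr := energyForm_self_nonneg (u - energyProjector W u)
  rw [smootherForm_apply]
  -- For `p = 1` the reduced space carries no boundary conditions, but the inverse inequality then
  -- holds for `u` itself, and the mass term alone dominates the energy.
  rcases hp.eq_or_lt with rfl | hp
  · have h1 := integral_deriv_sq_le_of_linear (n := n) (f := (u : ℝ → ℝ)) u.2.2.2
    have h2 : energyForm 1 n u u ≤ 13 * ((n : ℝ) ^ 2 * massForm 1 n u u) := by
      rw [massForm_apply] at hm ⊢
      rw [energyForm_apply]
      simp only [← sq] at hm ⊢
      nlinarith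
    linarith
  · obtain ⟨q, rfl⟩ : ∃ q, p = q + 2 := ⟨p - 2, by omega⟩
    rw [energyForm_projector_pythagoras W u]
    have ht : energyProjector W u ∈ W := Submodule.projection_apply_mem (energyForm_isCompl W) u
    have h0 := energyForm_projector_sub W u _ ht
    have htR := hW ht
    generalize energyProjector W u = t at *
    suffices h : energyForm (q + 2) n t t ≤ 13 * ((n : ℝ) ^ 2 * massForm (q + 2) n u u) by linarith
    have h1 : energyForm (q + 2) n t t = energyForm (q + 2) n t u := by
      rw [map_sub] at h0; linarith
    have hts : ContDiffOn ℝ ((q + 1 : ℕ) : WithTop ℕ∞) (t : ℝ → ℝ) (Icc 0 1) := t.2.2.1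
    set w := derivWithin (t : ℝ → ℝ) (Icc (0 : ℝ) 1) with hw
    have hwp : IsPiecewisePolynomial (q + 1) n w :=
      IsPiecewisePolynomial.derivWithin (p := q + 1) t.2.2.2
    have hws : ContDiffOn ℝ (q : WithTop ℕ∞) w (Icc 0 1) :=
      hts.derivWithin uniqueDiffOn_Icc_zero_one (by exact_mod_cast le_rfl)
    -- The vanishing odd derivatives of `t` are the even derivatives of `w = t'`, whence `ε = 0`.
    have h2 := integral_deriv_sq_le q 0 w hwp hws (fun k hk he => by
      obtain ⟨l, rfl⟩ := even_iff_exists_two_mul.1 he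
      have := htR l (by omega)
      rwa [iteratedDerivWithin_succ', ← hw] at this)
    have hwbd : w 0 = 0 ∧ w 1 = 0 := by
      have := htR 0 (by omega)
      simpa only [mul_zero, zero_add, iteratedDerivWithin_one, ← hw] using this
    have hwP := hwp.isPiecewisePrimitive hws.continuousOn
    have huP := SplineSpace.isPiecewisePrimitive u
    have h3 := hwP.integral_mul huP
    have hdw : ∀ x ∈ Ioo (0 : ℝ) 1, deriv (t : ℝ → ℝ) x = w x := fun x hx => by
      rw [hw, derivWithin_Icc_eq hx]
    have h4 := hwP.boundedPiecewise.sq_integral_mul_le huP.bounded zero_le_one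
      (left_mem_Icc.2 zero_le_one) (right_mem_Icc.2 zero_le_one)
    have h5 := (SplineSpace.isPiecewisePrimitive t).bounded.sq_integral_mul_le huP.bounded zero_le_one
      (left_mem_Icc.2 zero_le_one) (right_mem_Icc.2 zero_le_one)
    have e1 : energyForm (q + 2) n t t = (∫ x in (0 : ℝ)..1, w x ^ 2) +
        ∫ x in (0 : ℝ)..1, (t : ℝ → ℝ) x ^ 2 := by
      rw [energyForm_apply]
      simp only [← sq]
      rw [integral_congr_Ioo fun x hx => by rw [hdw x hx]]
    have e2 : energyForm (q + 2) n t u = -(∫ x in (0 : ℝ)..1, deriv w x * (u : ℝ → ℝ) x) +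
        ∫ x in (0 : ℝ)..1, (t : ℝ → ℝ) x * (u : ℝ → ℝ) x := by
      rw [energyForm_apply, integral_congr_Ioo fun x hx => by rw [hdw x hx], h3, hwbd.1, hwbd.2]
      ring
    have e3 : massForm (q + 2) n u u = ∫ x in (0 : ℝ)..1, (u : ℝ → ℝ) x ^ 2 := by
      simp only [massForm_apply, ← sq]
    have nA := integral_sq_nonneg w
    have nB := integral_sq_nonneg (t : ℝ → ℝ)
    have nU := integral_sq_nonneg (u : ℝ → ℝ)
    rw [e1, e2] at h1
    rw [e1, e3]
    generalize (∫ x in (0 : ℝ)..1, w x ^ 2) = A at *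
    generalize (∫ x in (0 : ℝ)..1, (t : ℝ → ℝ) x ^ 2) = B at *
    generalize (∫ x in (0 : ℝ)..1, (u : ℝ → ℝ) x ^ 2) = U at *
    generalize (∫ x in (0 : ℝ)..1, deriv w x ^ 2) = D at *
    generalize (∫ x in (0 : ℝ)..1, deriv w x * (u : ℝ → ℝ) x) = y at *
    generalize (∫ x in (0 : ℝ)..1, (t : ℝ → ℝ) x * (u : ℝ → ℝ) x) = z at *
    generalize (n : ℝ) ^ 2 = N at *
    have k1 : y ^ 2 ≤ 12 * N * A * U := h4.trans (mul_le_mul_of_nonneg_right h2 nU)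
    have k2 : z ^ 2 ≤ N * B * U := by
      refine h5.trans (mul_le_mul_of_nonneg_right ?_ nU)
      nlinarith
    -- Young's inequality `(z - y)² ≤ 13 z² + (13/12) y²`, weighted so that `k1` and `k2` give the
    -- same factor `13 N U` for `A` and for `B`.
    have k3 : (A + B) ^ 2 ≤ (13 * (N * U)) * (A + B) := by
      have : (A + B) ^ 2 ≤ 13 * z ^ 2 + 13 / 12 * y ^ 2 := by
        rw [h1]; nlinarith [sq_nonneg (12 * z + y)]
      linarith
    rcases (add_nonneg nA nB).eq_or_lt with h | h
    · rw [← h]; positivity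
    · rw [sq] at k3
      exact le_of_mul_le_mul_right k3 h

/-- The approximation property: on the energy-orthogonal complement of the coarse spline space, the
smoother is bounded by the energy. -/
theorem smootherForm_le_energyForm {N : ℕ} [NeZero N] (hN : N = 2 * n) (hp : 1 ≤ p)
    (W : Submodule ℝ (SplineSpace p N)) (e : SplineSpace p N)
    (h : ∀ χ : SplineSpace p N, (χ : ℝ → ℝ) ∈ SplineSpace p n → energyForm p N χ e = 0)
    (hle : SplineSpace p n ≤ SplineSpace p N) :
    smootherForm W e e ≤ 12 * energyForm p N e e := by
  obtain ⟨q, rfl⟩ : ∃ q, p = q + 1 := ⟨p - 1, by omega⟩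
  have hn : (0 : ℝ) < n := by exact_mod_cast NeZero.pos n
  have hNr : (N : ℝ) = 2 * n := by rw [hN]; push_cast; rfl
  have h1 := integral_sq_le_of_orthogonal (n := n) (SplineSpace.isPiecewisePrimitive e) fun χ hχ => by
    have := h ⟨χ, hle hχ⟩ hχ
    rwa [energyForm_symm, energyForm_apply] at this
  have h2 := energyForm_projector_pythagoras W e
  have h3 := energyForm_self_nonneg (energyProjector W e)
  have h4 : energyForm (q + 1) N e e = (∫ x in (0 : ℝ)..1, deriv (e : ℝ → ℝ) x ^ 2) +
      ∫ x in (0 : ℝ)..1, (e : ℝ → ℝ) x ^ 2 := by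
    simp only [energyForm_apply, ← sq]
  have h5 : massForm (q + 1) N e e = ∫ x in (0 : ℝ)..1, (e : ℝ → ℝ) x ^ 2 := by
    simp only [massForm_apply, ← sq]
  rw [← h4, ← h5] at h1
  rw [smootherForm_apply]
  -- The coarse mesh size is twice the fine one, so the factor is `4 * 8/3`. The projected part of
  -- the smoother adds at most `1`, and `35/3 ≤ 12`.
  have h6 : (N : ℝ) ^ 2 * massForm (q + 1) N e e ≤ 32 / 3 * energyForm (q + 1) N e e := by
    calc (N : ℝ) ^ 2 * massForm (q + 1) N e e ≤
          (N : ℝ) ^ 2 * (8 / 3 * (1 / (n : ℝ)) ^ 2 * energyForm (q + 1) N e e) := by gcongr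
      _ = _ := by rw [hNr]; field_simp; ring
  have h7 := energyForm_self_nonneg e
  linarith

end Estimates

/-! ### The matrices and their forms -/

section Bridge

variable {p n : ℕ} [NeZero n] {ι : Type*} [Fintype ι] [DecidableEq ι]

theorem toBilin'_toMatrix (b : Module.Basis ι ℝ (SplineSpace p n))
    (B : LinearMap.BilinForm ℝ (SplineSpace p n)) (v w : ι → ℝ) :
    Matrix.toBilin' (LinearMap.BilinForm.toMatrix b B) v w =
      B (b.equivFun.symm v) (b.equivFun.symm w) := by
  rw [LinearMap.BilinForm.apply_eq_dotProduct_toMatrix_mulVec b, Matrix.toBilin'_apply']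
  simp only [← Module.Basis.equivFun_apply, LinearEquiv.apply_symm_apply]

theorem posDef_toMatrix (b : Module.Basis ι ℝ (SplineSpace p n))
    {B : LinearMap.BilinForm ℝ (SplineSpace p n)} (hs : ∀ u v, B u v = B v u)
    (hpos : ∀ u, u ≠ 0 → 0 < B u u) : (LinearMap.BilinForm.toMatrix b B).PosDef := by
  refine Matrix.PosDef.of_dotProduct_mulVec_pos ?_ fun v hv => ?_
  · ext i j
    simp [LinearMap.BilinForm.toMatrix_apply, hs (b i) (b j)]
  · rw [star_trivial, ← Matrix.toBilin'_apply', toBilin'_toMatrix]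
    exact hpos _ ((LinearEquiv.map_ne_zero_iff _).2 hv)

theorem stiffnessMatrix_eq (b : Module.Basis ι ℝ (SplineSpace p n)) :
    stiffnessMatrix b = LinearMap.BilinForm.toMatrix b (energyForm p n) := by
  ext i j; simp [stiffnessMatrix, LinearMap.BilinForm.toMatrix_apply]

theorem massMatrix_eq (b : Module.Basis ι ℝ (SplineSpace p n)) :
    massMatrix b = LinearMap.BilinForm.toMatrix b (massForm p n) := by
  ext i j; simp [massMatrix, LinearMap.BilinForm.toMatrix_apply]

theorem smootherMatrix_eq (b : Module.Basis ι ℝ (SplineSpace p n))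
    (W : Submodule ℝ (SplineSpace p n)) :
    smootherMatrix b W = LinearMap.BilinForm.toMatrix b (smootherForm W) := by
  rw [smootherMatrix, smootherForm, stiffnessMatrix_eq, massMatrix_eq]
  simp only [map_add, map_smul]
  congr 1
  have h := LinearMap.BilinForm.toMatrix_comp b b (energyForm p n) (1 - energyProjector W)
    (1 - energyProjector W)
  have hT : LinearMap.toMatrix b b (1 - energyProjector W) =
      1 - LinearMap.toMatrix b b (energyProjector W) := by
    rw [← LinearMap.toMatrix_one b]
    exact map_sub (LinearMap.toMatrix b b) _ _
  rw [hT] at h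
  exact h.symm

theorem posDef_stiffnessMatrix (b : Module.Basis ι ℝ (SplineSpace p n)) :
    (stiffnessMatrix b).PosDef := by
  rw [stiffnessMatrix_eq]
  refine posDef_toMatrix b energyForm_symm fun u hu => ?_
  exact (energyForm_self_nonneg u).lt_of_ne' fun h => hu (eq_zero_of_energyForm_self u h)

/-- Definiteness is inherited from the energy through `energyForm_le_smootherForm`. -/
theorem posDef_smootherMatrix (b : Module.Basis ι ℝ (SplineSpace p n)) (hp : 1 ≤ p)
    {W : Submodule ℝ (SplineSpace p n)} (hW : W ≤ ReducedSplineSpace p n) :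
    (smootherMatrix b W).PosDef := by
  rw [smootherMatrix_eq]
  refine posDef_toMatrix b (fun u v => ?_) fun u hu => ?_
  · rw [smootherForm_apply, smootherForm_apply, energyForm_symm]
    simp only [massForm_apply, mul_comm]
  · have h1 := energyForm_le_smootherForm W hp hW u
    have h2 := (energyForm_self_nonneg u).lt_of_ne' fun h => hu (eq_zero_of_energyForm_self u h)
    linarith

end Bridge

/-! ### Prolongation, the Galerkin relation and the approximation property for matrices -/

section Prolongation

variable {p n₀ ℓ : ℕ} [NeZero n₀] {ι κ : Type*} [Fintype ι] [DecidableEq ι] [Fintype κ]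
  [DecidableEq κ] (bc : Module.Basis κ ℝ (SplineSpace p (n₀ * 2 ^ ℓ)))
  (bf : Module.Basis ι ℝ (SplineSpace p (n₀ * 2 ^ (ℓ + 1))))

theorem equivFun_symm_prolongationMatrix (c : κ → ℝ) :
    bf.equivFun.symm (prolongationMatrix bc bf *ᵥ c) =
      Submodule.inclusion (SplineSpace.le_succ p n₀ ℓ) (bc.equivFun.symm c) := by
  rw [LinearEquiv.symm_apply_eq, Module.Basis.equivFun_apply, ← LinearMap.toMatrix_mulVec_repr bc bf,
    ← Module.Basis.equivFun_apply, LinearEquiv.apply_symm_apply]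
  rfl

/-- The Galerkin relation between the stiffness matrices of consecutive levels. -/
theorem prolongationMatrix_galerkin :
    (prolongationMatrix bc bf)ᵀ * stiffnessMatrix bf * prolongationMatrix bc bf =
      stiffnessMatrix bc := by
  refine Matrix.toBilin'.injective (LinearMap.ext₂ fun v w => ?_)
  have h := Matrix.toBilin'_comp (stiffnessMatrix bf) (prolongationMatrix bc bf)
    (prolongationMatrix bc bf)
  rw [← h, LinearMap.BilinForm.comp_apply, stiffnessMatrix_eq, stiffnessMatrix_eq,
    toBilin'_toMatrix, toBilin'_toMatrix, Matrix.toLin'_apply, Matrix.toLin'_apply,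
    equivFun_symm_prolongationMatrix, equivFun_symm_prolongationMatrix]
  rfl

theorem toBilin'_smootherMatrix_le (hp : 1 ≤ p)
    (W : Submodule ℝ (SplineSpace p (n₀ * 2 ^ (ℓ + 1)))) (e : ι → ℝ)
    (h : ∀ c, Matrix.toBilin' (stiffnessMatrix bf) (prolongationMatrix bc bf *ᵥ c) e = 0) :
    Matrix.toBilin' (smootherMatrix bf W) e e ≤ 12 * Matrix.toBilin' (stiffnessMatrix bf) e e := by
  rw [stiffnessMatrix_eq] at h ⊢
  rw [smootherMatrix_eq, toBilin'_toMatrix, toBilin'_toMatrix]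
  refine smootherForm_le_energyForm (n := n₀ * 2 ^ ℓ) (by ring) hp W _ (fun χ hχ => ?_)
    (SplineSpace.le_succ p n₀ ℓ)
  have := h (bc.equivFun ⟨χ, hχ⟩)
  rwa [toBilin'_toMatrix, equivFun_symm_prolongationMatrix, LinearEquiv.symm_apply_apply] at this

end Prolongation

end

/-! ### The convergence theorem -/

theorem theorem4p5 :
    ∃ τ : ℝ, 0 < τ ∧ ∃ ν₀ : ℝ, 0 < ν₀ ∧
      -- spline degree `p`, number `n₀` of cells of the coarsest grid
      ∀ (p : ℕ), 1 ≤ p → ∀ (n₀ : ℕ) [NeZero n₀], p < n₀ →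
      -- bases of the spline spaces (such as the B-spline bases) and subspaces on all levels
      ∀ (ι : ℕ → Type) [∀ ℓ, Fintype (ι ℓ)] [∀ ℓ, DecidableEq (ι ℓ)]
        (b : ∀ ℓ, Module.Basis (ι ℓ) ℝ (SplineSpace p (n₀ * 2 ^ ℓ)))
        (SI : ∀ ℓ, Submodule ℝ (SplineSpace p (n₀ * 2 ^ ℓ))),
        (∀ ℓ, SI ℓ ≤ ReducedSplineSpace p (n₀ * 2 ^ ℓ)) →
      -- the method is well defined
      (∀ ℓ, (stiffnessMatrix (b ℓ)).PosDef ∧ (smootherMatrix (b ℓ) (SI ℓ)).PosDef) ∧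
      -- the two-grid method with `ν` smoothing steps on level `ℓ + 1`
      (∀ (ℓ ν : ℕ), ν₀ < ν → ∀ f uex u : ι (ℓ + 1) → ℝ,
        stiffnessMatrix (b (ℓ + 1)) *ᵥ uex = f →
        matrixNorm (smootherMatrix (b (ℓ + 1)) (SI (ℓ + 1)))
            (uex - twoGridStep (stiffnessMatrix (b (ℓ + 1)))
              (smootherMatrix (b (ℓ + 1)) (SI (ℓ + 1))) (stiffnessMatrix (b ℓ))
              (prolongationMatrix (b ℓ) (b (ℓ + 1))) τ ν f u) ≤
          ν₀ / ν * matrixNorm (smootherMatrix (b (ℓ + 1)) (SI (ℓ + 1))) (uex - u)) ∧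
      -- the W-cycle with `ν / 2` pre- and `ν / 2` post-smoothing steps on level `ℓ`
      (∀ (ℓ ν : ℕ), Even ν → 4 * ν₀ < ν → ∀ f uex u : ι ℓ → ℝ,
        stiffnessMatrix (b ℓ) *ᵥ uex = f →
        matrixNorm (stiffnessMatrix (b ℓ))
            (uex - wCycleStep (fun k => stiffnessMatrix (b k))
              (fun k => smootherMatrix (b k) (SI k))
              (fun k => prolongationMatrix (b k) (b (k + 1))) τ (ν / 2) ℓ f u) ≤
          2 * ν₀ / ν * matrixNorm (stiffnessMatrix (b ℓ)) (uex - u)) := by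
  -- `τ` is the reciprocal of the constant in `A ≤ 13 L`, and `ν₀ = K / τ` with `K = 12` from the
  -- approximation property.
  refine ⟨13⁻¹, by norm_num, 156, by norm_num, ?_⟩
  intro p hp n₀ _ _ ι _ _ b SI hSI
  have hA := fun ℓ => posDef_stiffnessMatrix (b ℓ)
  have hL := fun ℓ => posDef_smootherMatrix (b ℓ) hp (hSI ℓ)
  have hG := fun ℓ => prolongationMatrix_galerkin (b ℓ) (b (ℓ + 1))
  have hAL : ∀ ℓ v, (13 : ℝ)⁻¹ * Matrix.toBilin' (stiffnessMatrix (b ℓ)) v v ≤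
      Matrix.toBilin' (smootherMatrix (b ℓ) (SI ℓ)) v v := by
    intro ℓ v
    rw [stiffnessMatrix_eq, smootherMatrix_eq, toBilin'_toMatrix, toBilin'_toMatrix]
    have := energyForm_le_smootherForm (SI ℓ) hp (hSI ℓ) ((b ℓ).equivFun.symm v)
    linarith
  have hK := fun ℓ e => toBilin'_smootherMatrix_le (b ℓ) (b (ℓ + 1)) hp (SI (ℓ + 1)) e
  refine ⟨fun ℓ => ⟨hA ℓ, hL ℓ⟩, ?_, ?_⟩
  · rintro ℓ ν hν f uex u rfl
    have hν0 : (0 : ℝ) < ν := by linarith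
    refine (matrixNorm_sub_twoGridStep_le (hA (ℓ + 1)) (hL (ℓ + 1)) (hA ℓ) (hG ℓ) (by norm_num)
      (by norm_num) (hAL (ℓ + 1)) (hK ℓ) ν uex u).trans ?_
    refine mul_le_mul_of_nonneg_right ?_ (Real.sqrt_nonneg _)
    norm_num
    gcongr
    linarith
  · rintro ℓ ν ⟨m, rfl⟩ hν f uex u rfl
    rw [← two_mul, Nat.mul_div_cancel_left m two_pos]
    push_cast at hν
    -- With `ν = 2 m`, the condition `4 ν₀ ≤ 2 m + 1` follows from `4 ν₀ < ν`, and the rate `2 ν₀ /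
    -- (ν + 1)` is below the claimed one.
    refine (matrixNorm_sub_wCycleStep_le (L := fun k => smootherMatrix (b k) (SI k)) hA hL hG
      (by norm_num) (by norm_num) hAL hK (by norm_num; linarith) ℓ uex u).trans ?_
    refine mul_le_mul_of_nonneg_right ?_ (Real.sqrt_nonneg _)
    push_cast
    have hm : (0 : ℝ) < m := by linarith
    rw [mul_div_assoc]
    norm_num
    gcongr
    linarith
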